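/- Let $d,m\ge 1$. Let $Q=(q_{ij}):\mathbb{R}^d\to\mathbb{R}^{d\times d}$ be symmetric with bounded, continuously differentiable entries whose derivatives are bounded, and suppose that there are $\eta_1,\eta_2>0$ with $\eta_1|\xi|^2\le\langle Q(x)\xi,\xi\rangle\le\eta_2|\xi|^2$ for all $x,\xi\in\mathbb{R}^d$. Let $V=(v_{ij}):\mathbb{R}^d\to\mathbb{R}^{m\times m}$ have entries in $L^\infty_{\mathrm{loc}}(\mathbb{R}^d)$ and satisfy $\operatorname{Re}\langle V(x)\xi,\xi\rangle\ge 0$ for all $x\in\mathbb{R}^d$, $\xi\in\mathbb{C}^m$. Write $H^1=H^1(\mathbb{R}^d;\mathbb{C}^m)$, let $H^{-1}$ be its dual, realized as the space of bounded antilinear functionals on $H^1$, with duality pairing $[F,u]:=F(u)$, and regard $H^1\subset H^{-1}$ through $[u,v]=\int_{\mathbb{R}^d}\langle u,v\rangle\,dx$. For $u\in H^1$ let $\mathcal{A}u=\operatorname{div}(Q\nabla u)-Vu$ be the distribution $$\langle\mathcal{A}u,\varphi\rangle=-\int_{\mathbb{R}^d}\sum_{k=1}^m\sum_{i,j=1}^d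 q_{ij}\,\partial_iu_k\,\overline{\partial_j\varphi_k}\,dx-\int_{\mathbb{R}^d}\langle Vu,\varphi\rangle\,dx,\qquad\varphi\in C_c^\infty(\mathbb{R}^d;\mathbb{C}^m),$$ and say that $\mathcal{A}u\in H^{-1}$ if there is $F\in H^{-1}$ with $[F,\varphi]=\langle\mathcal{A}u,\varphi\rangle$ for all $\varphi\in C_c^\infty(\mathbb{R}^d;\mathbb{C}^m)$; then $\mathcal{A}u$ is identified with $F$. Let $L$ be the operator from $H^1$ to $H^{-1}$ given by $$Lu=\mathcal{A}u,\qquad D(L)=\{u\in H^1:\mathcal{A}u\in H^{-1}\},$$ and let $L_0$ be its restriction to $C_c^\infty(\mathbb{R}^d;\mathbb{C}^m)$. For a linear operator $T$ from $H^1$ to $H^{-1}$, its adjoint $T^*$ is the linear relation of all $(v,G)\in H^1\times H^{-1}$ such that $[G,u]=\overline{[Tu,v]}$ for all $u\in D(T)$; adjoints of relations are defined in the same way. **Theorem.** The operator $L$ is well defined (the functional $F$ above is unique), $C_c^\infty(\mathbb{R}^d;\mathbb{C}^m)\subset D(L)$, and: 1. $-L$ is maximal monotone: $\operatorname{Re}[-Lu,u]\ge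 0$ for all $u\in D(L)$, and the graph of $-L$ has no proper extension to a subset $T$ of $H^1\times H^{-1}$ with $\operatorname{Re}[F-G,u-v]\ge0$ for all $(u,F),(v,G)\in T$. Moreover, for every $f\in H^{-1}$ there is exactly one $u\in D(L)$ with $u-Lu=f$. 2. $L_0$ is closable, and $L$ is its closure, which equals $L_0^{**}$. -/

import Mathlib

open MeasureTheory Distributions
open scoped ENNReal ContDiff ComplexConjugate

noncomputable section

namespace VecSchrodinger

/-- The Euclidean space of dimension `d` over the reals. -/
abbrev Rd (d : ℕ) : Type := EuclideanSpace ℝ (Fin d)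

/-- The Euclidean (Hermitian) space of dimension `m` over the complex numbers. -/
abbrev Cm (m : ℕ) : Type := EuclideanSpace ℂ (Fin m)

/-- The Lebesgue space of square integrable functions with values in `Cm m`. -/
abbrev L2 (d m : ℕ) : Type := Lp (Cm m) 2 (volume : Measure (Rd d))

/-- Smooth compactly supported functions on `Rd d` with values in `F`. -/
abbrev Test (d : ℕ) (F : Type*) [NormedAddCommGroup F] [NormedSpace ℝ F] : Type _ :=
  𝓓((⊤ : TopologicalSpace.Opens (Rd d)), F)

/-- The classical partial derivative in the `i`-th coordinate direction. -/
def pderiv {d : ℕ} {F : Type*} [NormedAddCommGroup F] [NormedSpace ℝ F]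
    (i : Fin d) (f : Rd d → F) (x : Rd d) : F :=
  fderiv ℝ f x (EuclideanSpace.single i 1)

/-- `g` is the distributional `i`-th partial derivative of `u`. -/
def IsWeakDeriv {d m : ℕ} (i : Fin d) (u g : L2 d m) : Prop :=
  ∀ ψ : Test d ℝ, ∫ x, pderiv i ψ x • u x = -∫ x, ψ x • g x

/-- The Hilbert space in which the pairs (function, gradient) live. -/
abbrev L2Grad (d m : ℕ) : Type :=
  WithLp 2 (L2 d m × PiLp 2 (fun _ : Fin d => L2 d m))

/-- Square integrable functions are integrable against test functions. -/
lemma integrable_smul {d m : ℕ} (u : L2 d m) {ψ : Rd d → ℝ} (hc : Continuous ψ)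
    (hs : HasCompactSupport ψ) : Integrable (fun x => ψ x • u x) (volume : Measure (Rd d)) :=
  memLp_one_iff_integrable.1
    (MemLp.smul (p := 2) (q := 2) (r := 1) (Lp.memLp u) (hc.memLp_of_hasCompactSupport hs))

lemma continuous_pderiv {d : ℕ} {F : Type*} [NormedAddCommGroup F] [NormedSpace ℝ F]
    (i : Fin d) (φ : Test d F) : Continuous (pderiv i φ) :=
  (φ.contDiff.continuous_fderiv (by simp)).clm_apply continuous_const

lemma hasCompactSupport_pderiv {d : ℕ} {F : Type*} [NormedAddCommGroup F] [NormedSpace ℝ F]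
    (i : Fin d) (φ : Test d F) : HasCompactSupport (pderiv i φ) :=
  φ.hasCompactSupport.fderiv_apply ℝ (EuclideanSpace.single i 1)

lemma IsWeakDeriv.add {d m : ℕ} {i : Fin d} {u g u' g' : L2 d m} (h : IsWeakDeriv i u g)
    (h' : IsWeakDeriv i u' g') : IsWeakDeriv i (u + u') (g + g') := by
  intro ψ
  have e1 : ∫ x, pderiv i ψ x • (u + u') x
      = ∫ x, (pderiv i ψ x • u x + pderiv i ψ x • u' x) := by
    refine integral_congr_ae ?_
    filter_upwards [Lp.coeFn_add u u'] with x hx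
    rw [hx, Pi.add_apply, smul_add]
  have e2 : ∫ x, ψ x • (g + g') x = ∫ x, (ψ x • g x + ψ x • g' x) := by
    refine integral_congr_ae ?_
    filter_upwards [Lp.coeFn_add g g'] with x hx
    rw [hx, Pi.add_apply, smul_add]
  rw [e1, e2, integral_add (integrable_smul u (continuous_pderiv i ψ) (hasCompactSupport_pderiv i ψ))
      (integrable_smul u' (continuous_pderiv i ψ) (hasCompactSupport_pderiv i ψ)),
    integral_add (integrable_smul g ψ.continuous ψ.hasCompactSupport)
      (integrable_smul g' ψ.continuous ψ.hasCompactSupport), h ψ, h' ψ]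
  abel

lemma IsWeakDeriv.smul {d m : ℕ} {i : Fin d} {u g : L2 d m} (c : ℂ) (h : IsWeakDeriv i u g) :
    IsWeakDeriv i (c • u) (c • g) := by
  intro ψ
  have e1 : ∫ x, pderiv i ψ x • (c • u) x = ∫ x, c • (pderiv i ψ x • u x) := by
    refine integral_congr_ae ?_
    filter_upwards [Lp.coeFn_smul c u] with x hx
    rw [hx, Pi.smul_apply, smul_comm]
  have e2 : ∫ x, ψ x • (c • g) x = ∫ x, c • (ψ x • g x) := by
    refine integral_congr_ae ?_
    filter_upwards [Lp.coeFn_smul c g] with x hx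
    rw [hx, Pi.smul_apply, smul_comm]
  rw [e1, e2, integral_smul, integral_smul, h ψ, smul_neg]

lemma IsWeakDeriv.zero {d m : ℕ} (i : Fin d) : IsWeakDeriv i (0 : L2 d m) 0 := by
  intro ψ
  have e : ∀ f : Rd d → ℝ, ∫ x, f x • (0 : L2 d m) x = 0 := fun f => by
    refine integral_eq_zero_of_ae ?_
    filter_upwards [Lp.coeFn_zero (Cm m) 2 (volume : Measure (Rd d))] with x hx
    rw [hx]
    simp
  rw [e, e, neg_zero]

/-- The Sobolev space of square integrable functions whose first order distributional derivatives
are square integrable. An element is stored as a pair `(u, (∂₁ u, …, ∂_d u))`; the gradient is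
determined by `u`, and the norm is `(‖u‖² + ∑ᵢ ‖∂ᵢ u‖²) ^ (1 / 2)` with `L²` norms. -/
def H1 (d m : ℕ) : Submodule ℂ (L2Grad d m) where
  carrier := {p | ∀ i, IsWeakDeriv i p.fst (p.snd i)}
  add_mem' h h' i := (h i).add (h' i)
  smul_mem' c _ h i := (h i).smul c
  zero_mem' i := IsWeakDeriv.zero i

/-- The underlying `L²` function of an element of the Sobolev space. -/
def fn {d m : ℕ} (u : H1 d m) : L2 d m := (u : L2Grad d m).fst

/-- The `i`-th weak partial derivative of an element of the Sobolev space. -/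
def grad {d m : ℕ} (u : H1 d m) (i : Fin d) : L2 d m := (u : L2Grad d m).snd i

/-- The dual space of the Sobolev space, realized as the space of bounded *antilinear* functionals,
so that the duality pairing `[F, u]` is `F u`; it is linear in `F` and antilinear in `u` and
extends the pairing `∫ ⟨f, u⟩ dx` of square integrable functions. -/
abbrev Hneg1 (d m : ℕ) : Type := H1 d m →L⋆[ℂ] ℂ

/-- The canonical embedding of the Sobolev space into its antidual: `[u, v] = ∫ ⟨u, v⟩ dx`. -/
def emb (d m : ℕ) : H1 d m →ₗ[ℂ] Hneg1 d m where
  toFun u :=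
    LinearMap.mkContinuous
      { toFun := fun v => inner ℂ (fn v) (fn u)
        map_add' := fun v w => inner_add_left (fn v) (fn w) (fn u)
        map_smul' := fun c v => inner_smul_left (fn v) (fn u) c }
      ‖(fn u)‖
      (fun v => by
        have h1 : ‖fn v‖ ≤ ‖v‖ := WithLp.norm_fst_le _ (v : L2Grad d m)
        calc ‖inner ℂ (fn v) (fn u)‖ ≤ ‖fn v‖ * ‖(fn u)‖ := norm_inner_le_norm _ _
          _ ≤ ‖v‖ * ‖(fn u)‖ := by gcongr
          _ = ‖(fn u)‖ * ‖v‖ := mul_comm _ _)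
  map_add' u u' := by
    ext v
    exact inner_add_right (fn v) (fn u) (fn u')
  map_smul' c u := by
    ext v
    exact inner_smul_right (fn v) (fn u) c

lemma memLp_test {d m : ℕ} (φ : Test d (Cm m)) :
    MemLp φ 2 (volume : Measure (Rd d)) :=
  φ.continuous.memLp_of_hasCompactSupport φ.hasCompactSupport

lemma memLp_pderiv {d m : ℕ} (i : Fin d) (φ : Test d (Cm m)) :
    MemLp (pderiv i φ) 2 (volume : Measure (Rd d)) :=
  (continuous_pderiv i φ).memLp_of_hasCompactSupport (hasCompactSupport_pderiv i φ)

/-- Classical derivatives of test functions are weak derivatives. -/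
lemma isWeakDeriv_test {d m : ℕ} (i : Fin d) (φ : Test d (Cm m)) :
    IsWeakDeriv i ((memLp_test φ).toLp _) ((memLp_pderiv i φ).toLp _) := by
  intro ψ
  have e1 : ∫ x, pderiv i ψ x • (memLp_test φ).toLp _ x = ∫ x, pderiv i ψ x • φ x := by
    refine integral_congr_ae ?_
    filter_upwards [(memLp_test φ).coeFn_toLp] with x hx
    rw [hx]
  have e2 : ∫ x, ψ x • (memLp_pderiv i φ).toLp _ x = ∫ x, ψ x • pderiv i φ x := by
    refine integral_congr_ae ?_
    filter_upwards [(memLp_pderiv i φ).coeFn_toLp] with x hx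
    rw [hx]
  rw [e1, e2]
  have key : ∫ x, ψ x • pderiv i φ x = -∫ x, pderiv i ψ x • φ x := by
    refine integral_smul_fderiv_eq_neg_fderiv_smul_of_integrable ?_ ?_ ?_ ?_ ?_
    · exact ((continuous_pderiv i ψ).smul φ.continuous).integrable_of_hasCompactSupport
        (hasCompactSupport_pderiv i ψ).smul_right
    · exact (ψ.continuous.smul (continuous_pderiv i φ)).integrable_of_hasCompactSupport
        ψ.hasCompactSupport.smul_right
    · exact (ψ.continuous.smul φ.continuous).integrable_of_hasCompactSupport
        ψ.hasCompactSupport.smul_right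
    · exact fun x _ => (ψ.contDiff.differentiable (by simp)) x
    · exact fun x _ => (φ.contDiff.differentiable (by simp)) x
  rw [key, neg_neg]

/-- The inclusion of the test functions into the Sobolev space. -/
def ofTest (d m : ℕ) : Test d (Cm m) →ₗ[ℂ] H1 d m where
  toFun φ := ⟨WithLp.toLp 2 ((memLp_test φ).toLp _,
      WithLp.toLp 2 (fun i => (memLp_pderiv i φ).toLp _)), fun i => isWeakDeriv_test i φ⟩
  map_add' φ ψ := by
    have h : ∀ i, pderiv i (φ + ψ : Test d (Cm m)) = pderiv i φ + pderiv i ψ := fun i => by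
      ext1 x
      simp only [pderiv, FunLike.coe_add, Pi.add_apply]
      rw [fderiv_add ((φ.contDiff.differentiable (by simp)) x)
        ((ψ.contDiff.differentiable (by simp)) x)]
      rfl
    apply Subtype.ext
    apply WithLp.ofLp_injective
    refine Prod.ext rfl ?_
    ext1 i
    change (memLp_pderiv i (φ + ψ)).toLp _
      = (memLp_pderiv i φ).toLp _ + (memLp_pderiv i ψ).toLp _
    rw [← MemLp.toLp_add]
    simp only [h]
  map_smul' c φ := by
    have h : ∀ i, pderiv i (c • φ : Test d (Cm m)) = c • pderiv i φ := fun i => by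
      ext1 x
      simp only [pderiv, FunLike.coe_smul, Pi.smul_apply]
      rw [fderiv_const_smul ((φ.contDiff.differentiable (by simp)) x)]
      rfl
    apply Subtype.ext
    apply WithLp.ofLp_injective
    refine Prod.ext rfl ?_
    ext1 i
    change (memLp_pderiv i (c • φ)).toLp _ = c • (memLp_pderiv i φ).toLp _
    rw [← MemLp.toLp_const_smul]
    simp only [h]

/-- The action of a real matrix on a complex vector. -/
def matVec {m : ℕ} (B : Matrix (Fin m) (Fin m) ℝ) (ξ : Cm m) : Cm m :=
  WithLp.toLp 2 (fun i => ∑ j, (B i j : ℂ) * ξ j)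

/-- The standing assumptions on the diffusion matrix `Q`: symmetric, with bounded `C¹` entries
whose derivatives are bounded, and uniformly elliptic. -/
structure DiffusionHyp {d : ℕ} (Q : Rd d → Matrix (Fin d) (Fin d) ℝ) : Prop where
  symm : ∀ x i j, Q x i j = Q x j i
  contDiff : ∀ i j, ContDiff ℝ 1 (fun x => Q x i j)
  bounded : ∀ i j, ∃ C : ℝ, ∀ x, |Q x i j| ≤ C
  bounded_fderiv : ∀ i j, ∃ C : ℝ, ∀ x, ‖fderiv ℝ (fun y => Q y i j) x‖ ≤ C
  elliptic : ∃ η₁ η₂ : ℝ, 0 < η₁ ∧ 0 < η₂ ∧ ∀ x ξ : Rd d,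
    η₁ * ‖ξ‖ ^ 2 ≤ ∑ i, ∑ j, Q x i j * ξ i * ξ j ∧
      ∑ i, ∑ j, Q x i j * ξ i * ξ j ≤ η₂ * ‖ξ‖ ^ 2

/-- The standing assumptions on the potential `V`: locally bounded measurable entries and
pointwise accretivity. In Mathlib the inner product is antilinear in its first argument, so
`inner ℂ ξ (matVec (V x) ξ)` is `⟨V(x) ξ, ξ⟩`. -/
structure PotentialHyp {d m : ℕ} (V : Rd d → Matrix (Fin m) (Fin m) ℝ) : Prop where
  locBounded : ∀ i j, ∀ r : ℝ, 0 < r →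
    MemLp (fun x => V x i j) ∞ (volume.restrict (Metric.closedBall (0 : Rd d) r))
  accretive : ∀ (x : Rd d) (ξ : Cm m), 0 ≤ (inner ℂ ξ (matVec (V x) ξ)).re

/-- The distribution `𝒜 u = div (Q ∇u) - V u`, for `u` in the Sobolev space, paired with a
vector-valued test function `φ`:
`⟨𝒜 u, φ⟩ = - ∫ ∑ₖ ⟨∇uₖ, ∇φₖ⟩_Q dx - ∫ ⟨V u, φ⟩ dx` (antilinear in `φ`). -/
def distA {d m : ℕ} (Q : Rd d → Matrix (Fin d) (Fin d) ℝ) (V : Rd d → Matrix (Fin m) (Fin m) ℝ)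
    (u : H1 d m) (φ : Test d (Cm m)) : ℂ :=
  -(∫ x, ∑ i, ∑ j, (Q x i j : ℂ) * inner ℂ (pderiv j φ x) (grad u i x))
    - ∫ x, inner ℂ (φ x) (matVec (V x) ((fn u) x))

lemma memLp_comp {d m : ℕ} (u : L2 d m) (k : Fin m) :
    MemLp (fun x => u x k) 2 (volume : Measure (Rd d)) :=
  (Lp.memLp u).continuousLinearMap_comp (EuclideanSpace.proj (𝕜 := ℂ) k)

lemma integrable_diffusion {d m : ℕ} {Q : Rd d → Matrix (Fin d) (Fin d) ℝ}
    (hQ : DiffusionHyp Q) (i j : Fin d) (g : L2 d m) (φ : Test d (Cm m)) :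
    Integrable (fun x => (Q x i j : ℂ) * inner ℂ (pderiv j φ x) (g x)) := by
  obtain ⟨C, hC⟩ := hQ.bounded i j
  refine Integrable.bdd_mul (c := C) ?_ ?_ ?_
  · refine (L2.integrable_inner (𝕜 := ℂ) ((memLp_pderiv j φ).toLp _) g).congr ?_
    filter_upwards [(memLp_pderiv j φ).coeFn_toLp] with x hx
    rw [hx]
  · exact (Complex.continuous_ofReal.comp (hQ.contDiff i j).continuous).aestronglyMeasurable
  · refine Filter.Eventually.of_forall fun x => ?_
    rw [Complex.norm_real]
    exact hC x

lemma integrable_potential {d m : ℕ} {V : Rd d → Matrix (Fin m) (Fin m) ℝ}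
    (hV : PotentialHyp V) (u : L2 d m) (φ : Test d (Cm m)) :
    Integrable (fun x => inner ℂ (φ x) (matVec (V x) (u x))) := by
  obtain ⟨r, hr⟩ := φ.hasCompactSupport.isCompact.isBounded.subset_closedBall (0 : Rd d)
  have hr' : tsupport φ ⊆ Metric.closedBall (0 : Rd d) (max r 1) :=
    hr.trans (Metric.closedBall_subset_closedBall (le_max_left _ _))
  have hterm : ∀ k j, Integrable
      (fun x => (V x k j : ℂ) * (u x j * conj (φ x k))) (volume : Measure (Rd d)) := fun k j => by
    have h1 : MemLp (fun x => u x j * conj (φ x k)) 1 (volume : Measure (Rd d)) := by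
      refine MemLp.mul (p := 2) (q := 2) (r := 1) ?_ (memLp_comp u j)
      refine Continuous.memLp_of_hasCompactSupport ?_ ?_
      · have := φ.continuous
        fun_prop
      · exact φ.hasCompactSupport.comp_left (g := fun y : Cm m => conj (y k)) (by simp)
    have h2 : MemLp (fun x => (V x k j : ℂ)) ∞
        (volume.restrict (Metric.closedBall (0 : Rd d) (max r 1))) :=
      (hV.locBounded k j (max r 1) (by positivity)).ofReal
    have h3 : IntegrableOn (fun x => (V x k j : ℂ) * (u x j * conj (φ x k)))
        (Metric.closedBall (0 : Rd d) (max r 1)) :=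
      memLp_one_iff_integrable.1 (MemLp.mul (p := ∞) (q := 1) (r := 1) (h1.restrict _) h2)
    refine h3.integrable_of_forall_notMem_eq_zero fun x hx => ?_
    have : φ x = 0 := image_eq_zero_of_notMem_tsupport fun h => hx (hr' h)
    simp [this]
  have := integrable_finsetSum Finset.univ fun k _ =>
    integrable_finsetSum Finset.univ fun j _ => hterm k j
  refine this.congr (Filter.Eventually.of_forall fun x => ?_)
  simp only [matVec, PiLp.inner_apply, RCLike.inner_apply, Finset.sum_mul]
  exact Finset.sum_congr rfl fun k _ => Finset.sum_congr rfl fun j _ => by ring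

lemma matVec_add {m : ℕ} (B : Matrix (Fin m) (Fin m) ℝ) (ξ η : Cm m) :
    matVec B (ξ + η) = matVec B ξ + matVec B η := by
  ext i
  simp [matVec, mul_add, Finset.sum_add_distrib]

lemma matVec_smul {m : ℕ} (B : Matrix (Fin m) (Fin m) ℝ) (c : ℂ) (ξ : Cm m) :
    matVec B (c • ξ) = c • matVec B ξ := by
  ext i
  simp only [matVec, PiLp.smul_apply, smul_eq_mul, Finset.mul_sum]
  exact Finset.sum_congr rfl fun j _ => by ring

lemma distA_add {d m : ℕ} {Q : Rd d → Matrix (Fin d) (Fin d) ℝ}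
    {V : Rd d → Matrix (Fin m) (Fin m) ℝ} (hQ : DiffusionHyp Q) (hV : PotentialHyp V)
    (u w : H1 d m) (φ : Test d (Cm m)) :
    distA Q V (u + w) φ = distA Q V u φ + distA Q V w φ := by
  have hi : ∀ v : H1 d m, Integrable (fun x =>
      ∑ i, ∑ j, (Q x i j : ℂ) * inner ℂ (pderiv j φ x) (grad v i x)) := fun v =>
    integrable_finsetSum _ fun i _ => integrable_finsetSum _ fun j _ =>
      integrable_diffusion hQ i j (grad v i) φ
  have e1 : ∫ x, ∑ i, ∑ j, (Q x i j : ℂ) * inner ℂ (pderiv j φ x) (grad (u + w) i x)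
      = (∫ x, ∑ i, ∑ j, (Q x i j : ℂ) * inner ℂ (pderiv j φ x) (grad u i x))
        + ∫ x, ∑ i, ∑ j, (Q x i j : ℂ) * inner ℂ (pderiv j φ x) (grad w i x) := by
    rw [← integral_add (hi u) (hi w)]
    refine integral_congr_ae ?_
    filter_upwards [ae_all_iff.2 fun i => Lp.coeFn_add (grad u i) (grad w i)] with x hx
    rw [← Finset.sum_add_distrib]
    refine Finset.sum_congr rfl fun i _ => ?_
    rw [← Finset.sum_add_distrib]
    refine Finset.sum_congr rfl fun j _ => ?_
    rw [show grad (u + w) i = grad u i + grad w i from rfl, hx i, Pi.add_apply, inner_add_right,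
      mul_add]
  have e2 : ∫ x, inner ℂ (φ x) (matVec (V x) (fn (u + w) x))
      = (∫ x, inner ℂ (φ x) (matVec (V x) (fn u x)))
        + ∫ x, inner ℂ (φ x) (matVec (V x) (fn w x)) := by
    rw [← integral_add (integrable_potential hV (fn u) φ) (integrable_potential hV (fn w) φ)]
    refine integral_congr_ae ?_
    filter_upwards [Lp.coeFn_add (fn u) (fn w)] with x hx
    rw [show fn (u + w) = fn u + fn w from rfl, hx, Pi.add_apply, matVec_add, inner_add_right]
  unfold distA
  rw [e1, e2]
  ring

lemma distA_smul {d m : ℕ} (Q : Rd d → Matrix (Fin d) (Fin d) ℝ)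
    (V : Rd d → Matrix (Fin m) (Fin m) ℝ) (c : ℂ) (u : H1 d m) (φ : Test d (Cm m)) :
    distA Q V (c • u) φ = c * distA Q V u φ := by
  have e1 : ∫ x, ∑ i, ∑ j, (Q x i j : ℂ) * inner ℂ (pderiv j φ x) (grad (c • u) i x)
      = c * ∫ x, ∑ i, ∑ j, (Q x i j : ℂ) * inner ℂ (pderiv j φ x) (grad u i x) := by
    rw [← integral_const_mul]
    refine integral_congr_ae ?_
    filter_upwards [ae_all_iff.2 fun i => Lp.coeFn_smul c (grad u i)] with x hx
    rw [Finset.mul_sum]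
    refine Finset.sum_congr rfl fun i _ => ?_
    rw [Finset.mul_sum]
    refine Finset.sum_congr rfl fun j _ => ?_
    rw [show grad (c • u) i = c • grad u i from rfl, hx i, Pi.smul_apply, inner_smul_right]
    ring
  have e2 : ∫ x, inner ℂ (φ x) (matVec (V x) (fn (c • u) x))
      = c * ∫ x, inner ℂ (φ x) (matVec (V x) (fn u x)) := by
    rw [← integral_const_mul]
    refine integral_congr_ae ?_
    filter_upwards [Lp.coeFn_smul c (fn u)] with x hx
    rw [show fn (c • u) = c • fn u from rfl, hx, Pi.smul_apply, matVec_smul, inner_smul_right]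
  unfold distA
  rw [e1, e2]
  ring

/-- The set of all pairs `(u, F)` such that the antidual element `F` is the distribution `𝒜 u`,
that is, `[F, φ] = ⟨𝒜 u, φ⟩` for all test functions `φ`. -/
def graphL {d m : ℕ} {Q : Rd d → Matrix (Fin d) (Fin d) ℝ} {V : Rd d → Matrix (Fin m) (Fin m) ℝ}
    (hQ : DiffusionHyp Q) (hV : PotentialHyp V) : Submodule ℂ (H1 d m × Hneg1 d m) where
  carrier := {p | ∀ φ : Test d (Cm m), p.2 (ofTest d m φ) = distA Q V p.1 φ}
  add_mem' {p q} h h' φ := by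
    change p.2 (ofTest d m φ) + q.2 (ofTest d m φ) = distA Q V (p.1 + q.1) φ
    rw [distA_add hQ hV, h φ, h' φ]
  smul_mem' c p h φ := by
    change c * p.2 (ofTest d m φ) = distA Q V (c • p.1) φ
    rw [distA_smul, h φ]
  zero_mem' φ := by
    have := distA_smul Q V 0 (0 : H1 d m) φ
    rw [zero_smul, zero_mul] at this
    exact this.symm

/-- The realization `L` of `𝒜`: its domain consists of all `u` in the Sobolev space for which the
distribution `𝒜 u` belongs to the antidual, and `L u = 𝒜 u`. -/
def opL {d m : ℕ} {Q : Rd d → Matrix (Fin d) (Fin d) ℝ} {V : Rd d → Matrix (Fin m) (Fin m) ℝ}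
    (hQ : DiffusionHyp Q) (hV : PotentialHyp V) : H1 d m →ₗ.[ℂ] Hneg1 d m :=
  (graphL hQ hV).toLinearPMap

/-- The operator `L₀`: the operator `L` (that is, `𝒜`) restricted to the test functions. -/
def opL₀ {d m : ℕ} {Q : Rd d → Matrix (Fin d) (Fin d) ℝ} {V : Rd d → Matrix (Fin m) (Fin m) ℝ}
    (hQ : DiffusionHyp Q) (hV : PotentialHyp V) : H1 d m →ₗ.[ℂ] Hneg1 d m :=
  (opL hQ hV).domRestrict (LinearMap.range (ofTest d m))

/-- The adjoint of a relation (operator, via its graph) from the Sobolev space to its antidual,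
again such a relation: `(v, G)` belongs to it iff `[G, u]` is the complex conjugate of `[F, v]`
for all `(u, F)` in the given graph. -/
def adjointGraph {d m : ℕ} (S : Set (H1 d m × Hneg1 d m)) : Set (H1 d m × Hneg1 d m) :=
  {p | ∀ q ∈ S, p.2 q.1 = conj (q.2 p.1)}

/-- Monotonicity of a subset of the product of the Sobolev space and its antidual. -/
def IsMonotone {d m : ℕ} (S : Set (H1 d m × Hneg1 d m)) : Prop :=
  ∀ p ∈ S, ∀ q ∈ S, 0 ≤ ((p.2 - q.2) (p.1 - q.1)).re

/-- Maximal monotonicity: monotone, without a proper monotone extension. -/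
def IsMaximalMonotone {d m : ℕ} (S : Set (H1 d m × Hneg1 d m)) : Prop :=
  IsMonotone S ∧ ∀ T : Set (H1 d m × Hneg1 d m), IsMonotone T → S ⊆ T → T = S

end VecSchrodinger

end

/-! The difficulty is that `V` is bounded only on bounded sets: for `u` in the domain, `V u` is
merely locally square integrable, and `∫ ⟨V u, u⟩` need not be defined. Everything rests on showing
that the test functions are a core (`closure_graphTest`).

Let `D` be the bounded operator `-div (Q ∇·)` from `H1` to its antidual, and let `(u, F)` lie in the
graph. Then `F + D u` is an element of the antidual representing `-V u`. Since `V` commutes with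
scalar cutoffs `χₙ`, the functional `(F + D u) ∘ χₙ` represents `-V (χₙ u)`, so `(χₙ u, -D (χₙ u) +
(F + D u) ∘ χₙ)` is again in the graph (`mulTest_mem_graphL`); no commutator of `D` with `χₙ` has to
be computed. These pairs converge to `(u, F)` because `χₙ u → u` in `H1` and, through the Riesz
vector, `G ∘ χₙ → G` in norm for every `G`. Once the support is bounded, `V` acts as a bounded
multiplier, the operator is bounded, and mollification finishes the approximation.

Accretivity on test functions therefore passes to the limit (`re_le_of_mem_graphL`), and with
ellipticity `1 - L` is coercive, hence injective with closed range. On test functions the adjoint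
relation is exactly the distributional equation with `V` replaced by its transpose, so `L₀*` is the
operator `L` for the transposed potential (`adjointGraph_graphTest`). An element annihilating the
range of `1 - L` then lies in the kernel of `1 - L₀*`, which is trivial by the same coercivity;
hence `1 - L` is onto, and Minty's argument yields maximality. As a relation and its closure have
the same adjoint, taking the adjoint twice transposes twice and returns `L`. -/

noncomputable section

namespace VecSchrodinger

/-! ### Translations and mollification in `L²`. -/

open Filter Topology Metric in
/-- Translations act continuously on square integrable functions. -/
lemma exists_eLpNorm_translate_sub_le {d m : ℕ} (u : L2 d m) {ε : ℝ} (hε : 0 < ε) :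
    ∃ δ > 0, ∀ y : Rd d, ‖y‖ < δ →
      eLpNorm (fun x => u (x - y) - u x) 2 volume ≤ ENNReal.ofReal ε := by
  let g : C(Rd d, C(Rd d, Rd d)) :=
    (ContinuousMap.mk (fun a : Rd d × Rd d => a.2 - a.1) (by fun_prop)).curry
  have hg : ∀ y, MeasurePreserving (g y) volume volume := fun y =>
    measurePreserving_sub_right volume y
  have hc : Continuous fun y => Lp.compMeasurePreserving (g y) (hg y) u :=
    continuous_const.compMeasurePreservingLp g.continuous hg (by simp)
  have h0 : Lp.compMeasurePreserving (g 0) (hg 0) u = u := by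
    refine Lp.ext ?_
    filter_upwards [Lp.coeFn_compMeasurePreserving u (hg 0)] with x hx
    rw [hx]
    simp [g]
  obtain ⟨δ, hδ, H⟩ := Metric.continuous_iff.1 hc 0 ε hε
  refine ⟨δ, hδ, fun y hy => ?_⟩
  have := (H y (by simpa using hy)).le
  rw [h0, dist_eq_norm, Lp.norm_def] at this
  rw [← ENNReal.toReal_le_toReal ?_ ENNReal.ofReal_ne_top, ENNReal.toReal_ofReal hε.le]
  · refine le_trans (le_of_eq ?_) this
    congr 1
    refine eLpNorm_congr_ae ?_
    filter_upwards [Lp.coeFn_compMeasurePreserving u (hg y),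
      Lp.coeFn_sub (Lp.compMeasurePreserving (g y) (hg y) u) u] with x h1 h2
    rw [h2, Pi.sub_apply, h1]
    simp [g]
  · exact (((Lp.memLp u).comp_measurePreserving (hg y)).sub (Lp.memLp u)).eLpNorm_ne_top

/-- The convolution of a square integrable function with a normalized bump function. -/
def mollify {d m : ℕ} (ρ : ContDiffBump (0 : Rd d)) (u : L2 d m) : Rd d → Cm m :=
  MeasureTheory.convolution (ρ.normed volume) u (ContinuousLinearMap.lsmul ℝ ℝ) volume

lemma locallyIntegrable_L2 {d m : ℕ} (u : L2 d m) : LocallyIntegrable u volume :=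
  (Lp.memLp u).locallyIntegrable (by norm_num)

lemma contDiff_mollify {d m : ℕ} (ρ : ContDiffBump (0 : Rd d)) (u : L2 d m) :
    ContDiff ℝ ∞ (mollify ρ u) :=
  ρ.hasCompactSupport_normed.contDiff_convolution_left _ ρ.contDiff_normed
    (locallyIntegrable_L2 u)

lemma mollify_eq_zero {d m : ℕ} (ρ : ContDiffBump (0 : Rd d)) {u : L2 d m} {R : ℝ}
    (hu : ∀ᵐ x, R < ‖x‖ → u x = 0) {x : Rd d} (hx : R + ρ.rOut < ‖x‖) : mollify ρ u x = 0 := by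
  refine integral_eq_zero_of_ae ?_
  filter_upwards
    [(Measure.measurePreserving_sub_left volume x).quasiMeasurePreserving.ae hu] with t ht
  by_cases h : t ∈ Metric.ball (0 : Rd d) ρ.rOut
  · rw [ht (by
      have := norm_sub_norm_le x t
      rw [mem_ball_zero_iff] at h
      linarith)]
    simp
  · rw [← ρ.support_normed_eq (μ := volume)] at h
    rw [Function.notMem_support.1 h]
    simp

lemma mollify_eq_swap {d m : ℕ} (ρ : ContDiffBump (0 : Rd d)) (u : L2 d m) (x : Rd d) :
    mollify ρ u x = ∫ t, ρ.normed volume (x - t) • u t :=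
  convolution_lsmul_swap

/-- Mollification commutes with weak derivatives. -/
lemma pderiv_mollify {d m : ℕ} (ρ : ContDiffBump (0 : Rd d)) {i : Fin d} {u g : L2 d m}
    (h : IsWeakDeriv i u g) : pderiv i (mollify ρ u) = mollify ρ g := by
  ext1 x
  have hρ : ContDiff ℝ ∞ (ρ.normed (volume : Measure (Rd d))) := ρ.contDiff_normed
  -- The reflected kernel `t ↦ ρ (x - t)` is itself a test function; the sign from the inner
  -- derivative cancels the sign in the definition of the weak derivative.
  let ψ : Test d ℝ := ⟨fun t => ρ.normed volume (x - t), hρ.comp (contDiff_const.sub contDiff_id),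
    ρ.hasCompactSupport_normed.comp_homeomorph (Homeomorph.subLeft x), by simp⟩
  have hψ : ∀ t, pderiv i ψ t
      = -(fderiv ℝ (ρ.normed (volume : Measure (Rd d))) (x - t) (EuclideanSpace.single i 1)) := by
    intro t
    have h1 := ((hρ.differentiable (by simp)) (x - t)).hasFDerivAt.comp t
      ((hasFDerivAt_id t).const_sub x)
    have h2 : fderiv ℝ ψ t = _ := h1.fderiv
    rw [pderiv, h2]
    simp
  have hd := ρ.hasCompactSupport_normed.hasFDerivAt_convolution_left
    (ContinuousLinearMap.lsmul ℝ ℝ) (μ := volume) (hρ.of_le (by simp)) (locallyIntegrable_L2 u) x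
  have hi := ((ρ.hasCompactSupport_normed.fderiv ℝ).convolutionExists_left
    ((ContinuousLinearMap.lsmul ℝ ℝ (E := Cm m)).precompL (Rd d)) (hρ.continuous_fderiv (by simp))
    (locallyIntegrable_L2 u) x).integrable_swap
  rw [pderiv, show fderiv ℝ (mollify ρ u) x = _ from hd.fderiv, convolution_eq_swap,
    ContinuousLinearMap.integral_apply hi, mollify_eq_swap]
  have := h ψ
  simp only [hψ, neg_smul, integral_neg, neg_inj] at this
  exact this

/-- Jensen's inequality for averages against a probability measure. -/
lemma lintegral_sq_le {α : Type*} [MeasurableSpace α] (ν : Measure α) [IsProbabilityMeasure ν]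
    {f : α → ℝ≥0∞} (hf : AEMeasurable f ν) : (∫⁻ y, f y ∂ν) ^ 2 ≤ ∫⁻ y, f y ^ 2 ∂ν := by
  have := ENNReal.lintegral_mul_le_Lp_mul_Lq ν (p := 2) (q := 2)
    (by constructor <;> norm_num) hf (aemeasurable_const (b := (1 : ℝ≥0∞)))
  simp only [Pi.mul_apply, mul_one, ENNReal.one_rpow, lintegral_one, measure_univ] at this
  calc (∫⁻ y, f y ∂ν) ^ 2 ≤ ((∫⁻ y, f y ^ (2 : ℝ) ∂ν) ^ (1 / 2 : ℝ)) ^ 2 := by gcongr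
    _ = ∫⁻ y, f y ^ 2 ∂ν := by
      rw [← ENNReal.rpow_two, ← ENNReal.rpow_mul]
      simp

/-- The mollification error is bounded by the largest translation error. -/
lemma eLpNorm_mollify_sub_le {d m : ℕ} (ρ : ContDiffBump (0 : Rd d)) (u : L2 d m) {ε : ℝ≥0∞}
    (h : ∀ y : Rd d, ‖y‖ < ρ.rOut → eLpNorm (fun x => u (x - y) - u x) 2 volume ≤ ε) :
    eLpNorm (fun x => mollify ρ u x - u x) 2 volume ≤ ε := by
  have hρc : Continuous (ρ.normed (volume : Measure (Rd d))) := ρ.continuous_normed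
  have hum : Measurable u := (Lp.stronglyMeasurable u).measurable
  set w : Rd d → ℝ≥0∞ := fun y => ENNReal.ofReal (ρ.normed volume y) with hw
  have hwm : Measurable w := hρc.measurable.ennreal_ofReal
  -- The error is an average of translation differences against the probability measure with density
  -- `ρ`: Jensen moves the square inside, Tonelli exchanges the integrals.
  let ν : Measure (Rd d) := volume.withDensity w
  have : IsProbabilityMeasure ν := ⟨by
    rw [withDensity_apply _ MeasurableSet.univ, Measure.restrict_univ, hw,
      ← ofReal_integral_eq_lintegral_ofReal ρ.integrable_normed
        (Filter.Eventually.of_forall ρ.nonneg_normed), ρ.integral_normed, ENNReal.ofReal_one]⟩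
  have hF : Measurable fun p : Rd d × Rd d => ‖u (p.1 - p.2) - u p.1‖ₑ := by fun_prop
  have hpt : ∀ x, ‖mollify ρ u x - u x‖ₑ ^ 2 ≤ ∫⁻ y, w y * ‖u (x - y) - u x‖ₑ ^ 2 := by
    intro x
    have hi : Integrable (fun y => ρ.normed volume y • u (x - y)) :=
      ρ.hasCompactSupport_normed.convolutionExists_left (ContinuousLinearMap.lsmul ℝ ℝ)
        hρc (locallyIntegrable_L2 u) x
    have e : mollify ρ u x - u x = ∫ y, ρ.normed volume y • (u (x - y) - u x) := by
      simp only [smul_sub]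
      rw [integral_sub hi (ρ.integrable_normed.smul_const _), integral_smul_const,
        ρ.integral_normed, one_smul]
      rfl
    have hm : Measurable fun y => ‖u (x - y) - u x‖ₑ := by fun_prop
    calc ‖mollify ρ u x - u x‖ₑ ^ 2 ≤ (∫⁻ y, ‖u (x - y) - u x‖ₑ ∂ν) ^ 2 := by
          gcongr
          rw [e, lintegral_withDensity_eq_lintegral_mul _ hwm hm]
          refine (enorm_integral_le_lintegral_enorm _).trans (le_of_eq ?_)
          refine lintegral_congr fun y => ?_
          rw [enorm_smul, Pi.mul_apply, hw, Real.enorm_eq_ofReal (ρ.nonneg_normed y)]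
      _ ≤ ∫⁻ y, ‖u (x - y) - u x‖ₑ ^ 2 ∂ν := lintegral_sq_le ν hm.aemeasurable
      _ = _ := lintegral_withDensity_eq_lintegral_mul _ hwm (hm.pow_const 2)
  have key : ∀ f : Rd d → Cm m, eLpNorm f 2 volume = (∫⁻ x, ‖f x‖ₑ ^ 2) ^ (1 / 2 : ℝ) := fun f => by
    rw [eLpNorm_eq_lintegral_rpow_enorm_toReal (by norm_num) (by norm_num)]
    norm_num
  have key' : ∀ f : Rd d → Cm m, eLpNorm f 2 volume ≤ ε ↔ ∫⁻ x, ‖f x‖ₑ ^ 2 ≤ ε ^ 2 := fun f => by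
    rw [key, one_div, ENNReal.rpow_inv_le_iff (by norm_num), ENNReal.rpow_two]
  rw [key']
  calc ∫⁻ x, ‖mollify ρ u x - u x‖ₑ ^ 2 ≤ ∫⁻ x, ∫⁻ y, w y * ‖u (x - y) - u x‖ₑ ^ 2 :=
        lintegral_mono hpt
    _ = ∫⁻ y, ∫⁻ x, w y * ‖u (x - y) - u x‖ₑ ^ 2 := by
        refine lintegral_lintegral_swap (Measurable.aemeasurable ?_)
        exact (hwm.comp measurable_snd).mul (hF.pow_const 2)
    _ ≤ ∫⁻ y, w y * ε ^ 2 := by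
        refine lintegral_mono fun y => ?_
        rw [lintegral_const_mul _ (by fun_prop)]
        -- Long translations have no bound, but they carry no weight.
        by_cases hy : ‖y‖ < ρ.rOut
        · gcongr
          exact (key' _).1 (h y hy)
        · have : w y = 0 := by
            have : y ∉ Function.support (ρ.normed (volume : Measure (Rd d))) := by
              rw [ρ.support_normed_eq]
              simpa using hy
            rw [hw]
            simp [Function.notMem_support.1 this]
          simp [this]
    _ = ε ^ 2 := by
        rw [lintegral_mul_const _ hwm]
        have : ∫⁻ y, w y = 1 := by
          rw [← setLIntegral_univ, ← withDensity_apply _ MeasurableSet.univ]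
          exact measure_univ (μ := ν)
        rw [this, one_mul]

/-! ### The Sobolev space as a Hilbert space. -/

lemma norm_sq_H1 {d m : ℕ} (u : H1 d m) :
    ‖u‖ ^ 2 = ‖fn u‖ ^ 2 + ∑ i, ‖grad u i‖ ^ 2 := by
  change ‖(u : L2Grad d m)‖ ^ 2 = _
  rw [WithLp.prod_norm_sq_eq_of_L2, PiLp.norm_sq_eq_of_L2]
  rfl

lemma inner_H1 {d m : ℕ} (u v : H1 d m) :
    inner ℂ u v = inner ℂ (fn u) (fn v) + ∑ i, inner ℂ (grad u i) (grad v i) := by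
  change inner ℂ (u : L2Grad d m) (v : L2Grad d m) = _
  rw [WithLp.prod_inner_apply, PiLp.inner_apply]
  rfl

lemma norm_fn_le {d m : ℕ} (u : H1 d m) : ‖fn u‖ ≤ ‖u‖ :=
  WithLp.norm_fst_le _ (u : L2Grad d m)

lemma norm_grad_le {d m : ℕ} (u : H1 d m) (i : Fin d) : ‖grad u i‖ ≤ ‖u‖ :=
  (PiLp.norm_apply_le (u : L2Grad d m).snd i).trans (WithLp.norm_snd_le _ (u : L2Grad d m))

/-- Reduces convergence in `H1` to separate `L²` estimates for the function and each derivative. -/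
lemma norm_H1_le {d m : ℕ} (u : H1 d m) : ‖u‖ ≤ ‖fn u‖ + ∑ i, ‖grad u i‖ := by
  refine abs_le_of_sq_le_sq' ?_ (by positivity) |>.2
  rw [norm_sq_H1]
  have h := Finset.sum_sq_le_sq_sum_of_nonneg (s := Finset.univ) (f := fun i => ‖grad u i‖)
    (fun i _ => norm_nonneg _)
  have h2 : 0 ≤ ‖fn u‖ * ∑ i, ‖grad u i‖ := by positivity
  nlinarith

/-- The map from the Sobolev space to the underlying square integrable functions. -/
def fnL (d m : ℕ) : H1 d m →L[ℂ] L2 d m :=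
  LinearMap.mkContinuous { toFun := fn, map_add' := fun _ _ => rfl, map_smul' := fun _ _ => rfl } 1
    fun u => by rw [one_mul]; exact norm_fn_le u

/-- The weak partial derivative as a bounded operator on the Sobolev space. -/
def gradL (d m : ℕ) (i : Fin d) : H1 d m →L[ℂ] L2 d m :=
  LinearMap.mkContinuous
    { toFun := fun u => grad u i, map_add' := fun _ _ => rfl, map_smul' := fun _ _ => rfl } 1
    fun u => by rw [one_mul]; exact norm_grad_le u i

@[simp] lemma fnL_apply {d m : ℕ} (u : H1 d m) : fnL d m u = fn u := rfl

@[simp] lemma gradL_apply {d m : ℕ} (i : Fin d) (u : H1 d m) : gradL d m i u = grad u i := rfl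

lemma isWeakDeriv_grad {d m : ℕ} (u : H1 d m) (i : Fin d) : IsWeakDeriv i (fn u) (grad u i) :=
  u.2 i

/-- Integration of a square integrable function against a fixed test function is continuous. -/
lemma continuous_integral_smul {d m : ℕ} {ψ : Rd d → ℝ} (hc : Continuous ψ)
    (hs : HasCompactSupport ψ) : Continuous fun u : L2 d m => ∫ x, ψ x • u x := by
  have hψ : MemLp ψ 2 (volume : Measure (Rd d)) := hc.memLp_of_hasCompactSupport hs
  have h := ((ContinuousLinearMap.lsmul ℝ ℝ (E := Cm m)).lpPairing volume 2 2
    (hψ.toLp ψ)).continuous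
  refine h.congr fun u => ?_
  rw [ContinuousLinearMap.lpPairing_eq_integral]
  refine integral_congr_ae ?_
  filter_upwards [hψ.coeFn_toLp] with x hx
  rw [hx]
  rfl

/-- Both sides of the identity defining a weak derivative are continuous in `L²` for each fixed test
function. The resulting completeness is needed for the Riesz representation and for the closed range
argument. -/
lemma isClosed_H1 (d m : ℕ) : IsClosed (H1 d m : Set (L2Grad d m)) := by
  have : (H1 d m : Set (L2Grad d m)) = ⋂ (i : Fin d) (ψ : Test d ℝ),
      {p : L2Grad d m | ∫ x, pderiv i ψ x • p.fst x = -∫ x, ψ x • p.snd i x} := by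
    ext p
    simp only [Set.mem_iInter]
    rfl
  rw [this]
  refine isClosed_iInter fun i => isClosed_iInter fun ψ => isClosed_eq ?_ ?_
  · exact (continuous_integral_smul (continuous_pderiv i ψ) (hasCompactSupport_pderiv i ψ)).comp
      (WithLp.prod_continuous_ofLp 2 _ _).fst
  · exact ((continuous_integral_smul ψ.continuous ψ.hasCompactSupport).comp
      ((PiLp.continuous_apply 2 _ i).comp (WithLp.prod_continuous_ofLp 2 _ _).snd)).neg

instance (d m : ℕ) : CompleteSpace (H1 d m) :=
  (isClosed_H1 d m).completeSpace_coe

/-- The weak gradient is determined by the function. -/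
lemma fn_eq_zero {d m : ℕ} {u : H1 d m} (h : fn u = 0) : u = 0 := by
  have hg : ∀ i, grad u i = 0 := fun i => by
    refine Lp.ext ?_
    refine Filter.EventuallyEq.trans ?_ (Lp.coeFn_zero (Cm m) 2 volume).symm
    refine ae_eq_zero_of_integral_contDiff_smul_eq_zero (locallyIntegrable_L2 _) fun g hg hs => ?_
    have h1 := isWeakDeriv_grad u i ⟨g, hg, hs, by simp⟩
    rw [h] at h1
    have h2 := IsWeakDeriv.zero (m := m) i ⟨g, hg, hs, by simp⟩
    have h3 : ∫ x, g x • (0 : L2 d m) x = 0 := by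
      refine integral_eq_zero_of_ae ?_
      filter_upwards [Lp.coeFn_zero (Cm m) 2 (volume : Measure (Rd d))] with x hx
      simp
    rw [h2, neg_inj] at h1
    exact h1.symm.trans h3
  rw [← norm_eq_zero, ← sq_eq_zero_iff, norm_sq_H1]
  simp [h, hg]

/-! ### Mollification of Sobolev functions with bounded support. -/

lemma ofTest_fn {d m : ℕ} (φ : Test d (Cm m)) : fn (ofTest d m φ) =ᵐ[volume] φ :=
  (memLp_test φ).coeFn_toLp

lemma ofTest_grad {d m : ℕ} (φ : Test d (Cm m)) (i : Fin d) :
    grad (ofTest d m φ) i =ᵐ[volume] pderiv i φ :=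
  (memLp_pderiv i φ).coeFn_toLp

/-- Sobolev functions with bounded support are approximated by test functions with supports in a
fixed ball. -/
lemma exists_test_norm_sub_le {d m : ℕ} {u : H1 d m} {R : ℝ}
    (hu : ∀ᵐ x, R < ‖x‖ → fn u x = 0) {ε : ℝ} (hε : 0 < ε) :
    ∃ φ : Test d (Cm m), (∀ x, R + 1 < ‖x‖ → φ x = 0) ∧ ‖ofTest d m φ - u‖ ≤ ε := by
  -- There are `d + 1` components to control: the function and its `d` derivatives.
  set η : ℝ := ε / (d + 1) with hη
  have hη0 : 0 < η := by positivity
  obtain ⟨δ₀, hδ₀, h₀⟩ := exists_eLpNorm_translate_sub_le (fn u) hη0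
  choose δ hδ h using fun i => exists_eLpNorm_translate_sub_le (grad u i) hη0
  -- The bound by one keeps the support in the ball of radius `R + 1`; the others make every
  -- translation error small.
  obtain ⟨r, hr0, hr⟩ : ∃ r > 0, r ≤ 1 ∧ r ≤ δ₀ ∧ ∀ i, r ≤ δ i := by
    have : ∀ᶠ r in nhdsWithin (0 : ℝ) (Set.Ioi 0), r ≤ 1 ∧ r ≤ δ₀ ∧ ∀ i, r ≤ δ i := by
      have hl : ∀ c : ℝ, 0 < c → ∀ᶠ r in nhdsWithin (0 : ℝ) (Set.Ioi 0), r ≤ c := fun c hc =>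
        Filter.Eventually.filter_mono nhdsWithin_le_nhds (eventually_le_nhds hc)
      exact (hl 1 one_pos).and ((hl δ₀ hδ₀).and (Filter.eventually_all.2 fun i => hl _ (hδ i)))
    obtain ⟨r, h1, h2⟩ := (this.and self_mem_nhdsWithin).exists
    exact ⟨r, h2, h1⟩
  let ρ : ContDiffBump (0 : Rd d) := ⟨r / 2, r, by positivity, by linarith⟩
  have hsupp : ∀ x, R + 1 < ‖x‖ → mollify ρ (fn u) x = 0 := fun x hx =>
    mollify_eq_zero ρ hu (by
      change R + r < ‖x‖
      linarith)
  let φ : Test d (Cm m) := ⟨mollify ρ (fn u), contDiff_mollify ρ (fn u),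
    HasCompactSupport.intro (isCompact_closedBall (0 : Rd d) (R + 1))
      (fun x hx => hsupp x (by simpa using hx)), by simp⟩
  have hnorm : ∀ (v w : L2 d m), (w =ᵐ[volume] mollify ρ v) →
      (∀ y : Rd d, ‖y‖ < r → eLpNorm (fun x => v (x - y) - v x) 2 volume ≤ ENNReal.ofReal η) →
      ‖w - v‖ ≤ η := fun v w hw hv => by
    rw [Lp.norm_def]
    refine ENNReal.toReal_le_of_le_ofReal hη0.le ?_
    refine le_trans (le_of_eq (eLpNorm_congr_ae ?_)) (eLpNorm_mollify_sub_le ρ v hv)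
    filter_upwards [Lp.coeFn_sub w v, hw] with x h1 h2
    rw [h1, Pi.sub_apply, h2]
  refine ⟨φ, hsupp, (norm_H1_le _).trans ?_⟩
  have e0 : ‖fn (ofTest d m φ - u)‖ ≤ η :=
    hnorm (fn u) (fn (ofTest d m φ)) (ofTest_fn φ) fun y hy => h₀ y (hy.trans_le hr.2.1)
  have e1 : ∀ i, ‖grad (ofTest d m φ - u) i‖ ≤ η := fun i => by
    refine hnorm (grad u i) (grad (ofTest d m φ) i) ?_ fun y hy => h i y (hy.trans_le (hr.2.2 i))
    rw [← pderiv_mollify ρ (isWeakDeriv_grad u i)]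
    exact ofTest_grad φ i
  calc ‖fn (ofTest d m φ - u)‖ + ∑ i, ‖grad (ofTest d m φ - u) i‖ ≤ η + ∑ _i : Fin d, η := by
        gcongr with i
        exact e1 i
    _ = ε := by
        simp only [Finset.sum_const, Finset.card_univ, Fintype.card_fin, nsmul_eq_mul, hη]
        field_simp
        ring

/-! ### Multiplication operators and cutoffs. -/

/-- Multiplication of square integrable functions by a bounded real function. -/
def mulL {d : ℕ} (m : ℕ) {f : Rd d → ℝ} (hf : MemLp f ∞ (volume : Measure (Rd d))) :
    L2 d m →L[ℂ] L2 d m :=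
  (ContinuousLinearMap.lsmul ℂ ℂ (E := Cm m)).holderL volume ∞ 2 2
    ((hf.ofReal (K := ℂ)).toLp _)

lemma mulL_coeFn {d m : ℕ} {f : Rd d → ℝ} (hf : MemLp f ∞ (volume : Measure (Rd d)))
    (u : L2 d m) : mulL m hf u =ᵐ[volume] fun x => f x • u x := by
  filter_upwards [ContinuousLinearMap.coeFn_holder (r := 2)
    (ContinuousLinearMap.lsmul ℂ ℂ (E := Cm m)) ((hf.ofReal (K := ℂ)).toLp _) u,
    (hf.ofReal (K := ℂ)).coeFn_toLp] with x h1 h2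
  rw [mulL, ContinuousLinearMap.holderL_apply_apply, h1, h2]
  simp

lemma inner_mulL {d m : ℕ} {f : Rd d → ℝ} (hf : MemLp f ∞ (volume : Measure (Rd d)))
    (u v : L2 d m) : inner ℂ (mulL m hf u) v = inner ℂ u (mulL m hf v) := by
  rw [L2.inner_def, L2.inner_def]
  refine integral_congr_ae ?_
  filter_upwards [mulL_coeFn hf u, mulL_coeFn hf v] with x h1 h2
  rw [h1, h2, inner_smul_left_eq_smul, inner_smul_right_eq_smul]

lemma norm_sq_L2 {d m : ℕ} (u : L2 d m) : ‖u‖ ^ 2 = ∫ x, ‖u x‖ ^ 2 := by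
  have h := inner_self_eq_norm_sq_to_K (𝕜 := ℂ) u
  rw [L2.inner_def] at h
  simp only [inner_self_eq_norm_sq_to_K] at h
  have h2 : ∫ x, ((‖u x‖ ^ 2 : ℝ) : ℂ) = ((‖u‖ ^ 2 : ℝ) : ℂ) := by
    simpa using h
  rw [integral_complex_ofReal] at h2
  exact_mod_cast h2.symm

lemma integrable_norm_sq {d m : ℕ} (u : L2 d m) : Integrable fun x => ‖u x‖ ^ 2 :=
  (Lp.memLp u).integrable_norm_pow (p := 2) (by norm_num)

open Filter Topology in
/-- Dominated convergence for products with bounded functions. -/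
lemma tendsto_zero_of_ae_eq_smul {d m : ℕ} {w : ℕ → L2 d m} {u : L2 d m} {f : ℕ → Rd d → ℝ}
    (hw : ∀ n, w n =ᵐ[volume] fun x => f n x • u x) {C : ℝ} (hC : ∀ n x, |f n x| ≤ C)
    (hf : ∀ x, Tendsto (fun n => f n x) atTop (𝓝 0)) : Tendsto w atTop (𝓝 0) := by
  rw [tendsto_zero_iff_norm_tendsto_zero]
  suffices h : Tendsto (fun n => ‖w n‖ ^ 2) atTop (𝓝 0) by
    simpa using h.sqrt
  simp only [norm_sq_L2]
  rw [← integral_zero (Rd d) ℝ (μ := volume)]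
  refine tendsto_integral_of_dominated_convergence (fun x => C ^ 2 * ‖u x‖ ^ 2)
    (fun n => (integrable_norm_sq (w n)).aestronglyMeasurable)
    ((integrable_norm_sq u).const_mul _) (fun n => ?_) ?_
  · filter_upwards [hw n] with x hx
    rw [hx, norm_smul, mul_pow, norm_mul, norm_pow, norm_pow, norm_norm, norm_norm]
    gcongr
    exact hC n x
  · filter_upwards [ae_all_iff.2 hw] with x hx
    simp only [hx, norm_smul, mul_pow]
    simpa using ((hf x).norm.pow 2).mul_const (‖u x‖ ^ 2)

lemma memLp_top_test {d : ℕ} (χ : Test d ℝ) : MemLp χ ∞ (volume : Measure (Rd d)) :=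
  χ.continuous.memLp_of_hasCompactSupport χ.hasCompactSupport

lemma memLp_top_pderiv {d : ℕ} (χ : Test d ℝ) (i : Fin d) :
    MemLp (pderiv i χ) ∞ (volume : Measure (Rd d)) :=
  (continuous_pderiv i χ).memLp_of_hasCompactSupport (hasCompactSupport_pderiv i χ)

/-- The product rule for weak derivatives. -/
lemma IsWeakDeriv.mul_test {d m : ℕ} {i : Fin d} {u g : L2 d m} (h : IsWeakDeriv i u g)
    (χ : Test d ℝ) : IsWeakDeriv i (mulL m (memLp_top_test χ) u)
      (mulL m (memLp_top_test χ) g + mulL m (memLp_top_pderiv χ i) u) := by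
  intro ψ
  -- The weak derivative of `u` is tested against `ψ χ`; the classical product rule for `ψ χ` then
  -- gives the claim.
  let θ : Test d ℝ := ⟨fun x => ψ x * χ x, ψ.contDiff.mul χ.contDiff,
    ψ.hasCompactSupport.mul_right, by simp⟩
  have hθ : ∀ x, pderiv i θ x = pderiv i ψ x * χ x + ψ x * pderiv i χ x := fun x => by
    have := fderiv_mul (ψ.contDiff.differentiable (by simp) x)
      (χ.contDiff.differentiable (by simp) x)
    rw [pderiv, show fderiv ℝ θ x = _ from this]
    simp only [add_apply, smul_apply, smul_eq_mul, pderiv]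
    ring
  have h1 : Integrable fun x => (pderiv i ψ x * χ x) • u x :=
    integrable_smul u ((continuous_pderiv i ψ).mul χ.continuous)
      (hasCompactSupport_pderiv i ψ).mul_right
  have h2 : Integrable fun x => (ψ x * pderiv i χ x) • u x :=
    integrable_smul u (ψ.continuous.mul (continuous_pderiv i χ)) ψ.hasCompactSupport.mul_right
  have h3 : Integrable fun x => θ x • g x := integrable_smul g θ.continuous θ.hasCompactSupport
  have e := h θ
  simp only [hθ, add_smul] at e
  rw [integral_add h1 h2] at e
  have e1 : ∫ x, pderiv i ψ x • mulL m (memLp_top_test χ) u x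
      = ∫ x, (pderiv i ψ x * χ x) • u x := by
    refine integral_congr_ae ?_
    filter_upwards [mulL_coeFn (memLp_top_test χ) u] with x hx
    rw [hx, smul_smul]
  have e2 : ∫ x, ψ x • (mulL m (memLp_top_test χ) g + mulL m (memLp_top_pderiv χ i) u : L2 d m) x
      = ∫ x, (θ x • g x + (ψ x * pderiv i χ x) • u x) := by
    refine integral_congr_ae ?_
    filter_upwards [mulL_coeFn (memLp_top_test χ) g, mulL_coeFn (memLp_top_pderiv χ i) u,
      Lp.coeFn_add (mulL m (memLp_top_test χ) g) (mulL m (memLp_top_pderiv χ i) u)] with x a b c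
    rw [c, Pi.add_apply, a, b, smul_add, smul_smul, smul_smul]
    rfl
  rw [e1, e2, integral_add h3 h2, eq_sub_of_add_eq e]
  abel

/-- Multiplication of Sobolev functions by a test function. -/
def mulTest {d : ℕ} (m : ℕ) (χ : Test d ℝ) : H1 d m →L[ℂ] H1 d m :=
  ((WithLp.prodContinuousLinearEquiv 2 ℂ (L2 d m) (PiLp 2 fun _ : Fin d =>
    L2 d m)).symm.toContinuousLinearMap ∘L
    ((mulL m (memLp_top_test χ) ∘L fnL d m).prod
      ((PiLp.continuousLinearEquiv 2 ℂ fun _ : Fin d => L2 d m).symm.toContinuousLinearMap ∘L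
        ContinuousLinearMap.pi fun i => mulL m (memLp_top_test χ) ∘L gradL d m i
          + mulL m (memLp_top_pderiv χ i) ∘L fnL d m))).codRestrict (H1 d m)
    fun u i => (isWeakDeriv_grad u i).mul_test χ

lemma fn_mulTest {d m : ℕ} (χ : Test d ℝ) (u : H1 d m) :
    fn (mulTest m χ u) = mulL m (memLp_top_test χ) (fn u) := rfl

lemma grad_mulTest {d m : ℕ} (χ : Test d ℝ) (u : H1 d m) (i : Fin d) :
    grad (mulTest m χ u) i
      = mulL m (memLp_top_test χ) (grad u i) + mulL m (memLp_top_pderiv χ i) (fn u) := rfl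

open Filter Topology in
/-- A sequence of test functions converging to one with bounded derivatives converging to zero. -/
structure IsCutoff {d : ℕ} (χ : ℕ → Test d ℝ) : Prop where
  bounded : ∃ C, ∀ n x, |χ n x| ≤ C
  bounded_pderiv : ∃ C, ∀ n i x, |pderiv i (χ n) x| ≤ C
  tendsto : ∀ x, Tendsto (fun n => χ n x) atTop (𝓝 1)
  tendsto_pderiv : ∀ i x, Tendsto (fun n => pderiv i (χ n) x) atTop (𝓝 0)

open Filter Topology in
-- A fixed bump function is dilated by `n + 1`; the chain rule gives the factor `1 / (n + 1)` that
-- makes the derivatives vanish in the limit.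
lemma exists_isCutoff (d : ℕ) : ∃ χ : ℕ → Test d ℝ, IsCutoff χ := by
  let b : ContDiffBump (0 : Rd d) := ⟨1, 2, one_pos, one_lt_two⟩
  let B : Test d ℝ := ⟨b, b.contDiff, b.hasCompactSupport, by simp⟩
  have hpos : ∀ n : ℕ, (0 : ℝ) < ((n : ℝ) + 1)⁻¹ := fun n => by positivity
  let χ : ℕ → Test d ℝ := fun n => ⟨fun x => b (((n : ℝ) + 1)⁻¹ • x),
    b.contDiff.comp (contDiff_id.const_smul _),
    b.hasCompactSupport.comp_homeomorph (Homeomorph.smulOfNeZero _ (hpos n).ne'), by simp⟩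
  have hd : ∀ n i x, pderiv i (χ n) x = ((n : ℝ) + 1)⁻¹ * pderiv i B (((n : ℝ) + 1)⁻¹ • x) := by
    intro n i x
    have h := ((B.contDiff.differentiable (by simp)) (((n : ℝ) + 1)⁻¹ • x)).hasFDerivAt.comp x
      ((hasFDerivAt_id x).const_smul ((n : ℝ) + 1)⁻¹)
    rw [pderiv, show fderiv ℝ (χ n) x = _ from h.fderiv]
    simp [pderiv]
  obtain ⟨C, hC⟩ : ∃ C, ∀ i x, |pderiv i B x| ≤ C := by
    choose C hC using fun i =>
      (continuous_pderiv i B).bounded_above_of_compact_support (hasCompactSupport_pderiv i B)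
    exact ⟨∑ i, |C i|, fun i x => (hC i x).trans ((le_abs_self _).trans
      (Finset.single_le_sum (f := fun i => |C i|) (fun _ _ => abs_nonneg _) (Finset.mem_univ i)))⟩
  have hlim : Tendsto (fun n : ℕ => ((n : ℝ) + 1)⁻¹) atTop (𝓝 0) := by
    simpa using tendsto_one_div_add_atTop_nhds_zero_nat (𝕜 := ℝ)
  have hle : ∀ n i x, |pderiv i (χ n) x| ≤ ((n : ℝ) + 1)⁻¹ * C := fun n i x => by
    rw [hd, abs_mul, abs_of_pos (hpos n)]
    gcongr
    exact hC _ _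
  refine ⟨χ, ⟨1, fun n x => ?_⟩, ⟨|C|, fun n i x => (hle n i x).trans ?_⟩,
    fun x => ?_, fun i x => ?_⟩
  · change |b _| ≤ 1
    rw [abs_of_nonneg b.nonneg]
    exact b.le_one
  · calc ((n : ℝ) + 1)⁻¹ * C ≤ ((n : ℝ) + 1)⁻¹ * |C| :=
          mul_le_mul_of_nonneg_left (le_abs_self C) (hpos n).le
      _ ≤ 1 * |C| := mul_le_mul_of_nonneg_right
          (inv_le_one_of_one_le₀ (le_add_of_nonneg_left (Nat.cast_nonneg n))) (abs_nonneg C)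
      _ = |C| := one_mul _
  · have h1 : Tendsto (fun n : ℕ => b (((n : ℝ) + 1)⁻¹ • x)) atTop (𝓝 (b ((0 : ℝ) • x))) :=
      (b.continuous.tendsto _).comp (hlim.smul_const x)
    rwa [zero_smul, b.one_of_mem_closedBall (by simp [b])] at h1
  · refine squeeze_zero_norm (fun n => hle n i x) ?_
    simpa using hlim.mul_const C

open Filter Topology in
lemma IsCutoff.tendsto_mulL {d m : ℕ} {χ : ℕ → Test d ℝ} (hχ : IsCutoff χ) (u : L2 d m) :
    Tendsto (fun n => mulL m (memLp_top_test (χ n)) u) atTop (𝓝 u) := by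
  rw [← tendsto_sub_nhds_zero_iff]
  obtain ⟨C, hC⟩ := hχ.bounded
  refine tendsto_zero_of_ae_eq_smul (u := u) (f := fun n x => χ n x - 1) (C := C + 1) (fun n => ?_)
    (fun n x => ?_) fun x => ?_
  · filter_upwards [mulL_coeFn (memLp_top_test (χ n)) u,
      Lp.coeFn_sub (mulL m (memLp_top_test (χ n)) u) u] with x h1 h2
    rw [h2, Pi.sub_apply, h1, sub_smul, one_smul]
  · refine (abs_sub _ _).trans ?_
    rw [abs_one]
    gcongr
    exact hC n x
  · simpa using (hχ.tendsto x).sub_const 1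

open Filter Topology in
lemma IsCutoff.tendsto_mulL_pderiv {d m : ℕ} {χ : ℕ → Test d ℝ} (hχ : IsCutoff χ) (i : Fin d)
    (u : L2 d m) : Tendsto (fun n => mulL m (memLp_top_pderiv (χ n) i) u) atTop (𝓝 0) := by
  obtain ⟨C, hC⟩ := hχ.bounded_pderiv
  exact tendsto_zero_of_ae_eq_smul (fun n => mulL_coeFn (memLp_top_pderiv (χ n) i) u)
    (fun n x => hC n i x) (hχ.tendsto_pderiv i)

open Filter Topology in
-- In `∂ᵢ(χₙ u) = χₙ ∂ᵢu + (∂ᵢχₙ) u` the second term tends to zero in `L²`.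
lemma IsCutoff.tendsto_mulTest {d m : ℕ} {χ : ℕ → Test d ℝ} (hχ : IsCutoff χ) (u : H1 d m) :
    Tendsto (fun n => mulTest m (χ n) u) atTop (𝓝 u) := by
  rw [tendsto_iff_norm_sub_tendsto_zero]
  refine squeeze_zero (fun n => norm_nonneg _) (fun n => norm_H1_le _) ?_
  have h0 : Tendsto (fun n => ‖fn (mulTest m (χ n) u - u)‖) atTop (𝓝 0) :=
    tendsto_iff_norm_sub_tendsto_zero.1 (hχ.tendsto_mulL (fn u))
  have h1 : ∀ i, Tendsto (fun n => ‖grad (mulTest m (χ n) u - u) i‖) atTop (𝓝 0) := fun i => by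
    have := (hχ.tendsto_mulL (grad u i)).add (hχ.tendsto_mulL_pderiv i (fn u))
    rw [add_zero] at this
    exact tendsto_iff_norm_sub_tendsto_zero.1 this
  simpa using h0.add (tendsto_finsetSum Finset.univ fun i _ => h1 i)

/-! ### Truncation of antilinear functionals. -/

/-- The Riesz representation of bounded antilinear functionals on a Hilbert space. -/
lemma exists_eq_inner {H : Type*} [NormedAddCommGroup H] [InnerProductSpace ℂ H]
    [CompleteSpace H] (G : H →L⋆[ℂ] ℂ) : ∃ w : H, ∀ v, G v = inner ℂ v w := by
  let G' : H →L[ℂ] ℂ := ((starL ℂ : ℂ ≃L⋆[ℂ] ℂ) : ℂ →L⋆[ℂ] ℂ).comp G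
  refine ⟨(InnerProductSpace.toDual ℂ H).symm G', fun v => ?_⟩
  rw [← inner_conj_symm, InnerProductSpace.toDual_symm_apply]
  simp [G']

open Filter Topology in
/-- Antilinear functionals on the Sobolev space are approximated by their truncations. -/
lemma IsCutoff.tendsto_comp_mulTest {d m : ℕ} {χ : ℕ → Test d ℝ} (hχ : IsCutoff χ)
    (G : Hneg1 d m) : Tendsto (fun n => G.comp (mulTest m (χ n))) atTop (𝓝 G) := by
  -- The multipliers converge only strongly, not in operator norm. Moving them, by self-adjointness,
  -- from the varying `v` to the fixed Riesz vector `w` makes the convergence uniform on bounded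
  -- sets of `v`.
  obtain ⟨w, hw⟩ := exists_eq_inner (H := H1 d m) G
  let a : ℕ → ℝ := fun n => ‖mulL m (memLp_top_test (χ n)) (fn w) - fn w‖
    + ∑ i, (‖mulL m (memLp_top_test (χ n)) (grad w i) - grad w i‖
      + ‖mulL m (memLp_top_pderiv (χ n) i) (grad w i)‖)
  have ha : Tendsto a atTop (𝓝 0) := by
    have h0 := tendsto_iff_norm_sub_tendsto_zero.1 (hχ.tendsto_mulL (fn w))
    have h1 := fun i => (tendsto_iff_norm_sub_tendsto_zero.1 (hχ.tendsto_mulL (grad w i))).add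
      (hχ.tendsto_mulL_pderiv i (grad w i)).norm
    simpa using h0.add (tendsto_finsetSum Finset.univ fun i _ => h1 i)
  refine (tendsto_iff_norm_sub_tendsto_zero (E := Hneg1 d m)).2 ?_
  refine squeeze_zero (fun n => norm_nonneg (G.comp (mulTest m (χ n)) - G)) (fun n => ?_) ha
  refine ContinuousLinearMap.opNorm_le_bound _ (by positivity) fun v => ?_
  have e : (G.comp (mulTest m (χ n)) - G) v
      = inner ℂ (fn v) (mulL m (memLp_top_test (χ n)) (fn w) - fn w)
        + ∑ i, (inner ℂ (grad v i) (mulL m (memLp_top_test (χ n)) (grad w i) - grad w i)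
          + inner ℂ (fn v) (mulL m (memLp_top_pderiv (χ n) i) (grad w i))) := by
    rw [sub_apply, ContinuousLinearMap.comp_apply, hw, hw, inner_H1, inner_H1]
    simp only [fn_mulTest, grad_mulTest, inner_mulL, inner_add_left, inner_sub_right,
      Finset.sum_add_distrib, Finset.sum_sub_distrib]
    ring
  rw [e, add_mul, Finset.sum_mul]
  refine (norm_add_le _ _).trans (add_le_add ?_ ((norm_sum_le _ _).trans
    (Finset.sum_le_sum fun i _ => ?_)))
  · rw [mul_comm]
    exact (norm_inner_le_norm _ _).trans (by gcongr; exact norm_fn_le v)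
  · rw [add_mul, mul_comm _ ‖v‖, mul_comm _ ‖v‖]
    refine (norm_add_le _ _).trans (add_le_add ?_ ?_)
    · exact (norm_inner_le_norm _ _).trans (by gcongr; exact norm_grad_le v i)
    · exact (norm_inner_le_norm _ _).trans (by gcongr; exact norm_fn_le v)

/-! ### The diffusion form. -/

/-- The functional `v ↦ ⟨g, A v⟩` on the Sobolev space, for `g` square integrable. -/
def dualMap {d m : ℕ} (A : H1 d m →L[ℂ] L2 d m) : L2 d m →L[ℂ] Hneg1 d m :=
  LinearMap.mkContinuous
    { toFun := fun g => (innerSLFlip ℂ g).comp A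
      map_add' := fun g h => by
        ext v
        exact inner_add_right (A v) g h
      map_smul' := fun c g => by
        ext v
        exact inner_smul_right (A v) g c } ‖A‖
    fun g => by
      refine ContinuousLinearMap.opNorm_le_bound _ (by positivity) fun v => ?_
      calc ‖inner ℂ (A v) g‖ ≤ ‖A v‖ * ‖g‖ := norm_inner_le_norm _ _
        _ ≤ ‖A‖ * ‖v‖ * ‖g‖ := by
          gcongr
          exact A.le_opNorm v
        _ = ‖A‖ * ‖g‖ * ‖v‖ := by ring

lemma dualMap_apply {d m : ℕ} (A : H1 d m →L[ℂ] L2 d m) (g : L2 d m) (v : H1 d m) :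
    dualMap A g v = inner ℂ (A v) g := rfl

lemma DiffusionHyp.memLp_top {d : ℕ} {Q : Rd d → Matrix (Fin d) (Fin d) ℝ} (hQ : DiffusionHyp Q)
    (i j : Fin d) : MemLp (fun x => Q x i j) ∞ (volume : Measure (Rd d)) := by
  obtain ⟨C, hC⟩ := hQ.bounded i j
  exact memLp_top_of_bound (hQ.contDiff i j).continuous.aestronglyMeasurable C
    (Filter.Eventually.of_forall hC)

/-- The diffusion part `-div (Q ∇u)` as a bounded operator from the Sobolev space to its
antidual. -/
def diffusion {d : ℕ} (m : ℕ) {Q : Rd d → Matrix (Fin d) (Fin d) ℝ} (hQ : DiffusionHyp Q) :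
    H1 d m →L[ℂ] Hneg1 d m :=
  ∑ i, ∑ j, dualMap (gradL d m j) ∘L mulL m (hQ.memLp_top i j) ∘L gradL d m i

lemma diffusion_apply {d m : ℕ} {Q : Rd d → Matrix (Fin d) (Fin d) ℝ} (hQ : DiffusionHyp Q)
    (u v : H1 d m) : diffusion m hQ u v
      = ∑ i, ∑ j, inner ℂ (grad v j) (mulL m (hQ.memLp_top i j) (grad u i)) := by
  simp [diffusion, sum_apply, dualMap_apply]

/-- `Q` is real and symmetric, so the form is Hermitian and only the potential changes on passing to
the adjoint. -/
lemma diffusion_conj {d m : ℕ} {Q : Rd d → Matrix (Fin d) (Fin d) ℝ} (hQ : DiffusionHyp Q)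
    (u v : H1 d m) : conj (diffusion m hQ u v) = diffusion m hQ v u := by
  have e : ∀ i j, mulL m (hQ.memLp_top i j) = mulL m (hQ.memLp_top j i) := fun i j => by
    congr 1
    ext x
    exact hQ.symm x i j
  rw [diffusion_apply, diffusion_apply, Finset.sum_comm]
  simp only [map_sum]
  refine Finset.sum_congr rfl fun j _ => Finset.sum_congr rfl fun i _ => ?_
  rw [inner_conj_symm, inner_mulL, e]

lemma integral_diffusion {d m : ℕ} {Q : Rd d → Matrix (Fin d) (Fin d) ℝ} (hQ : DiffusionHyp Q)
    (g h : Fin d → L2 d m) :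
    ∫ x, ∑ i, ∑ j, (Q x i j : ℂ) * inner ℂ (h j x) (g i x)
      = ∑ i, ∑ j, inner ℂ (h j) (mulL m (hQ.memLp_top i j) (g i)) := by
  have e : ∀ i j, (fun x => inner ℂ (h j x) (mulL m (hQ.memLp_top i j) (g i) x))
      =ᵐ[volume] fun x => (Q x i j : ℂ) * inner ℂ (h j x) (g i x) := fun i j => by
    filter_upwards [mulL_coeFn (hQ.memLp_top i j) (g i)] with x hx
    rw [hx, inner_smul_right_eq_smul, Complex.real_smul]
  have hi : ∀ i j, Integrable fun x => (Q x i j : ℂ) * inner ℂ (h j x) (g i x) := fun i j =>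
    (L2.integrable_inner (𝕜 := ℂ) (h j) (mulL m (hQ.memLp_top i j) (g i))).congr (e i j)
  rw [integral_finsetSum _ fun i _ => integrable_finsetSum _ fun j _ => hi i j]
  refine Finset.sum_congr rfl fun i _ => ?_
  rw [integral_finsetSum _ fun j _ => hi i j]
  refine Finset.sum_congr rfl fun j _ => ?_
  rw [L2.inner_def]
  exact (integral_congr_ae (e i j)).symm

lemma diffusion_ofTest {d m : ℕ} {Q : Rd d → Matrix (Fin d) (Fin d) ℝ} (hQ : DiffusionHyp Q)
    (u : H1 d m) (φ : Test d (Cm m)) : diffusion m hQ u (ofTest d m φ)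
      = ∫ x, ∑ i, ∑ j, (Q x i j : ℂ) * inner ℂ (pderiv j φ x) (grad u i x) := by
  rw [diffusion_apply, ← integral_diffusion hQ (grad u) (grad (ofTest d m φ))]
  refine integral_congr_ae ?_
  filter_upwards [ae_all_iff.2 fun i => ofTest_grad φ i] with x hx
  simp only [hx]

/-- Real ellipticity implies ellipticity for vectors of complex vectors. -/
lemma elliptic_complex {d m : ℕ} {A : Matrix (Fin d) (Fin d) ℝ} {η : ℝ}
    (h : ∀ ξ : Rd d, η * ‖ξ‖ ^ 2 ≤ ∑ i, ∑ j, A i j * ξ i * ξ j) (w : Fin d → Cm m) :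
    η * ∑ i, ‖w i‖ ^ 2 ≤ (∑ i, ∑ j, (A i j : ℂ) * inner ℂ (w j) (w i)).re := by
  have h' : ∀ a : Fin d → ℝ, η * ∑ i, a i ^ 2 ≤ ∑ i, ∑ j, A i j * a i * a j := fun a => by
    have := h (WithLp.toLp 2 a)
    rw [EuclideanSpace.norm_sq_eq] at this
    simpa using this
  have e1 : ∑ i, ‖w i‖ ^ 2 = ∑ k, ((∑ i, (w i k).re ^ 2) + ∑ i, (w i k).im ^ 2) := by
    simp only [EuclideanSpace.norm_sq_eq, ← Finset.sum_add_distrib]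
    rw [Finset.sum_comm]
    refine Finset.sum_congr rfl fun k _ => Finset.sum_congr rfl fun i _ => ?_
    rw [← Complex.normSq_eq_norm_sq, Complex.normSq_apply]
    ring
  -- As `A` is real, the real part splits into real quadratic forms in the real and the imaginary
  -- parts of each coordinate `k`, to which real ellipticity applies.
  have e2 : (∑ i, ∑ j, (A i j : ℂ) * inner ℂ (w j) (w i)).re
      = ∑ k, ((∑ i, ∑ j, A i j * (w i k).re * (w j k).re)
        + ∑ i, ∑ j, A i j * (w i k).im * (w j k).im) := by
    simp only [Complex.re_sum, Complex.re_ofReal_mul, PiLp.inner_apply, Finset.mul_sum,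
      ← Finset.sum_add_distrib]
    rw [Finset.sum_comm (s := (Finset.univ : Finset (Fin m)))]
    refine Finset.sum_congr rfl fun i _ => ?_
    rw [Finset.sum_comm]
    refine Finset.sum_congr rfl fun k _ => Finset.sum_congr rfl fun j _ => ?_
    simp only [RCLike.inner_apply, Complex.mul_re, Complex.conj_re, Complex.conj_im]
    ring
  rw [e1, e2, Finset.mul_sum]
  refine Finset.sum_le_sum fun k _ => ?_
  rw [mul_add]
  exact add_le_add (h' _) (h' _)

lemma diffusion_re_ge {d m : ℕ} {Q : Rd d → Matrix (Fin d) (Fin d) ℝ} (hQ : DiffusionHyp Q)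
    {η : ℝ} (h : ∀ x ξ : Rd d, η * ‖ξ‖ ^ 2 ≤ ∑ i, ∑ j, Q x i j * ξ i * ξ j) (u : H1 d m) :
    η * ∑ i, ‖grad u i‖ ^ 2 ≤ (diffusion m hQ u u).re := by
  have hi : Integrable fun x => ∑ i, ∑ j, (Q x i j : ℂ) * inner ℂ (grad u j x) (grad u i x) := by
    refine integrable_finsetSum _ fun i _ => integrable_finsetSum _ fun j _ => ?_
    refine (L2.integrable_inner (𝕜 := ℂ) (grad u j)
      (mulL m (hQ.memLp_top i j) (grad u i))).congr ?_
    filter_upwards [mulL_coeFn (hQ.memLp_top i j) (grad u i)] with x hx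
    rw [hx, inner_smul_right_eq_smul, Complex.real_smul]
  rw [diffusion_apply, ← integral_diffusion hQ (grad u) (grad u)]
  have e : (∫ x, ∑ i, ∑ j, (Q x i j : ℂ) * inner ℂ (grad u j x) (grad u i x)).re
      = ∫ x, (∑ i, ∑ j, (Q x i j : ℂ) * inner ℂ (grad u j x) (grad u i x)).re :=
    (integral_re hi).symm
  rw [e]
  simp only [norm_sq_L2]
  rw [← integral_finsetSum _ fun i _ => integrable_norm_sq (grad u i), ← integral_const_mul]
  refine integral_mono ((integrable_finsetSum _ fun i _ => integrable_norm_sq _).const_mul _)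
    hi.re fun x => elliptic_complex (h x) fun i => grad u i x

/-! ### The potential as a bounded multiplier on balls. -/

/-- The bounded linear map of a matrix. -/
def matVecL {m : ℕ} (B : Matrix (Fin m) (Fin m) ℝ) : Cm m →L[ℂ] Cm m :=
  LinearMap.toContinuousLinearMap
    { toFun := matVec B, map_add' := matVec_add B, map_smul' := matVec_smul B }

@[simp] lemma matVecL_apply {m : ℕ} (B : Matrix (Fin m) (Fin m) ℝ) (ξ : Cm m) :
    matVecL B ξ = matVec B ξ := rfl

/-- Writes the operator-valued potential as scalar entries times constant operators, so that its
measurability and boundedness on balls follow from those of the entries. -/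
lemma matVecL_eq_sum {m : ℕ} (B : Matrix (Fin m) (Fin m) ℝ) :
    matVecL B = ∑ k, ∑ j, (B k j : ℂ) • matVecL (Matrix.single k j 1) := by
  ext ξ i
  simp [matVec, Matrix.single_apply, sum_apply, ite_and, Finset.sum_ite_eq,
    apply_ite Complex.ofReal,
    ite_mul]

lemma inner_matVec {m : ℕ} (B : Matrix (Fin m) (Fin m) ℝ) (ξ η : Cm m) :
    inner ℂ (matVec B ξ) η = inner ℂ ξ (matVec B.transpose η) := by
  simp only [PiLp.inner_apply, matVec, RCLike.inner_apply, map_sum, Finset.mul_sum, Finset.sum_mul,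
    map_mul, Complex.conj_ofReal, Matrix.transpose_apply]
  rw [Finset.sum_comm]
  exact Finset.sum_congr rfl fun i _ => Finset.sum_congr rfl fun j _ => by ring

/-- `⟨Vᵀξ, ξ⟩` is the complex conjugate of `⟨Vξ, ξ⟩`. Hence every result about `L` also holds for
the operator with transposed potential, which turns out to be the adjoint. -/
lemma PotentialHyp.transpose {d m : ℕ} {V : Rd d → Matrix (Fin m) (Fin m) ℝ}
    (hV : PotentialHyp V) : PotentialHyp fun x => (V x).transpose where
  locBounded i j := hV.locBounded j i
  accretive x ξ := by
    rw [← inner_matVec, ← inner_conj_symm, Complex.conj_re]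
    exact hV.accretive x ξ

lemma memLp_indicator_sum_ofReal_smul {α ι E : Type*} [MeasurableSpace α] {μ : Measure α}
    [Fintype ι] [NormedAddCommGroup E] [NormedSpace ℂ E] {p : ℝ≥0∞} {f : ι → α → ℝ} {s : Set α}
    (hs : MeasurableSet s) (hf : ∀ i, MemLp (f i) p (μ.restrict s)) (c : ι → E) :
    MemLp (s.indicator fun x => ∑ i, (f i x : ℂ) • c i) p μ := by
  refine (memLp_indicator_iff_restrict hs).2 (memLp_finsetSum _ fun i _ =>
    (hf i).of_le_mul (c := ‖c i‖) ?_ (Filter.Eventually.of_forall fun x => ?_))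
  · exact (Complex.continuous_ofReal.comp_aestronglyMeasurable
      (hf i).aestronglyMeasurable).smul_const _
  · rw [norm_smul, Complex.norm_real, mul_comm]

lemma PotentialHyp.memLp_indicator {d m : ℕ} {V : Rd d → Matrix (Fin m) (Fin m) ℝ}
    (hV : PotentialHyp V) {R : ℝ} (hR : 0 < R) :
    MemLp ((Metric.closedBall (0 : Rd d) R).indicator fun x => matVecL (V x)) ∞
      (volume : Measure (Rd d)) := by
  have h := memLp_indicator_sum_ofReal_smul (E := Cm m →L[ℂ] Cm m)
    (f := fun (p : Fin m × Fin m) x => V x p.1 p.2)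
    (Metric.isClosed_closedBall (x := (0 : Rd d)) (ε := R)).measurableSet
    (fun p => hV.locBounded p.1 p.2 R hR) fun p => matVecL (Matrix.single p.1 p.2 (1 : ℝ))
  have e : ∀ x, matVecL (V x)
      = ∑ p : Fin m × Fin m, (V x p.1 p.2 : ℂ) • matVecL (Matrix.single p.1 p.2 (1 : ℝ)) :=
    fun x => by rw [matVecL_eq_sum (V x), Fintype.sum_prod_type]
  simp_rw [e]
  exact h

/-- Multiplication by the potential, restricted to a ball. -/
def potL {d m : ℕ} {V : Rd d → Matrix (Fin m) (Fin m) ℝ} (hV : PotentialHyp V) {R : ℝ}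
    (hR : 0 < R) : L2 d m →L[ℂ] L2 d m :=
  (ContinuousLinearMap.id ℂ (Cm m →L[ℂ] Cm m)).holderL volume ∞ 2 2
    ((hV.memLp_indicator hR).toLp _)

lemma potL_coeFn {d m : ℕ} {V : Rd d → Matrix (Fin m) (Fin m) ℝ} (hV : PotentialHyp V) {R : ℝ}
    (hR : 0 < R) (u : L2 d m) : potL hV hR u =ᵐ[volume]
      (Metric.closedBall (0 : Rd d) R).indicator fun x => matVec (V x) (u x) := by
  filter_upwards [ContinuousLinearMap.coeFn_holder (r := 2)
    (ContinuousLinearMap.id ℂ (Cm m →L[ℂ] Cm m)) ((hV.memLp_indicator hR).toLp _) u,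
    (hV.memLp_indicator hR).coeFn_toLp] with x h1 h2
  rw [potL, ContinuousLinearMap.holderL_apply_apply, h1, h2]
  by_cases hx : x ∈ Metric.closedBall (0 : Rd d) R <;> simp only [hx, Set.indicator_of_mem,
    Set.indicator_of_notMem, not_false_iff] <;> rfl

lemma inner_potL {d m : ℕ} {V : Rd d → Matrix (Fin m) (Fin m) ℝ} (hV : PotentialHyp V) {R : ℝ}
    (hR : 0 < R) (u v : L2 d m) :
    inner ℂ (potL hV hR u) v = inner ℂ u (potL hV.transpose hR v) := by
  rw [L2.inner_def, L2.inner_def]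
  refine integral_congr_ae ?_
  filter_upwards [potL_coeFn hV hR u, potL_coeFn hV.transpose hR v] with x h1 h2
  rw [h1, h2]
  by_cases hx : x ∈ Metric.closedBall (0 : Rd d) R
  · rw [Set.indicator_of_mem hx, Set.indicator_of_mem hx, inner_matVec]
  · rw [Set.indicator_of_notMem hx, Set.indicator_of_notMem hx, inner_zero_left, inner_zero_right]

/-- The cutoff of `V` is invisible if either factor vanishes outside the ball; both cases occur,
bounded support of `u` and a test function against arbitrary `u`. -/
lemma inner_potL_ofTest {d m : ℕ} {V : Rd d → Matrix (Fin m) (Fin m) ℝ} (hV : PotentialHyp V)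
    {R : ℝ} (hR : 0 < R) {u : L2 d m} {φ : Test d (Cm m)}
    (h : ∀ᵐ x, R < ‖x‖ → φ x = 0 ∨ u x = 0) :
    inner ℂ (fn (ofTest d m φ)) (potL hV hR u) = ∫ x, inner ℂ (φ x) (matVec (V x) (u x)) := by
  rw [L2.inner_def]
  refine integral_congr_ae ?_
  filter_upwards [potL_coeFn hV hR u, ofTest_fn φ, h] with x h1 h2 h3
  rw [h1, h2]
  by_cases hx : x ∈ Metric.closedBall (0 : Rd d) R
  · rw [Set.indicator_of_mem hx]
  · rw [Set.indicator_of_notMem hx, inner_zero_right]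
    rcases h3 (by simpa using hx) with h | h
    · rw [h, inner_zero_left]
    · rw [h, show matVec (V x) 0 = 0 from map_zero (matVecL (V x)), inner_zero_right]

/-! ### Density of test functions. -/

lemma exists_eq_zero_of_lt_norm {d : ℕ} {F : Type*} [NormedAddCommGroup F] [NormedSpace ℝ F]
    (φ : Test d F) : ∃ R > 0, ∀ x, R < ‖x‖ → φ x = 0 := by
  obtain ⟨r, hr⟩ := φ.hasCompactSupport.isCompact.isBounded.subset_closedBall (0 : Rd d)
  refine ⟨max r 1, by positivity, fun x hx => image_eq_zero_of_notMem_tsupport fun h => ?_⟩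
  have := mem_closedBall_zero_iff.1 (hr h)
  exact absurd (this.trans (le_max_left r 1)) (not_le.2 hx)

lemma fn_mulTest_ae_eq_zero {d m : ℕ} {χ : Test d ℝ} {R : ℝ} (hχ : ∀ x, R < ‖x‖ → χ x = 0)
    (u : H1 d m) : ∀ᵐ x, R < ‖x‖ → fn (mulTest m χ u) x = 0 := by
  filter_upwards [mulL_coeFn (memLp_top_test χ) (fn u)] with x hx hr
  rw [fn_mulTest, hx, hχ x hr, zero_smul]

/-- The product of a scalar and a vector-valued test function. -/
def smulTest {d m : ℕ} (χ : Test d ℝ) (φ : Test d (Cm m)) : Test d (Cm m) :=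
  ⟨fun x => χ x • φ x, χ.contDiff.smul φ.contDiff, χ.hasCompactSupport.smul_right, by simp⟩

/-- Only the underlying functions need comparing, since these determine the weak gradients. -/
lemma mulTest_ofTest {d m : ℕ} (χ : Test d ℝ) (φ : Test d (Cm m)) :
    mulTest m χ (ofTest d m φ) = ofTest d m (smulTest χ φ) := by
  rw [← sub_eq_zero]
  refine fn_eq_zero (sub_eq_zero.2 (Lp.ext ?_) :
    fn (mulTest m χ (ofTest d m φ)) - fn (ofTest d m (smulTest χ φ)) = 0)
  filter_upwards [mulL_coeFn (memLp_top_test χ) (fn (ofTest d m φ)), ofTest_fn φ,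
    ofTest_fn (smulTest χ φ)] with x h1 h2 h3
  rw [fn_mulTest, h1, h2, h3]
  rfl

/-- Every Sobolev function is a limit of test functions. -/
lemma denseRange_ofTest (d m : ℕ) : DenseRange (ofTest d m) := by
  obtain ⟨χ, hχ⟩ := exists_isCutoff d
  intro u
  refine isClosed_closure.mem_of_tendsto (hχ.tendsto_mulTest u)
    (Filter.Eventually.of_forall fun n => ?_)
  obtain ⟨R, -, hR⟩ := exists_eq_zero_of_lt_norm (χ n)
  refine Metric.mem_closure_iff.2 fun ε hε => ?_
  obtain ⟨φ, -, hφ⟩ := exists_test_norm_sub_le (fn_mulTest_ae_eq_zero hR u) (half_pos hε)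
  refine ⟨_, ⟨φ, rfl⟩, ?_⟩
  rw [dist_comm, dist_eq_norm]
  linarith

lemma continuous_antilinear_apply {E : Type*} [NormedAddCommGroup E] [NormedSpace ℂ E] :
    Continuous fun p : (E →L⋆[ℂ] ℂ) × E => p.1 p.2 := by
  refine continuous_iff_continuousAt.2 fun q => ?_
  have h1 : Filter.Tendsto (fun p : (E →L⋆[ℂ] ℂ) × E => ‖p.1 - q.1‖ * ‖p.2‖) (nhds q)
      (nhds (‖q.1 - q.1‖ * ‖q.2‖)) :=
    ((continuous_fst.sub continuous_const).norm.mul continuous_snd.norm).tendsto q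
  rw [sub_self, norm_zero, zero_mul] at h1
  have h2 : Filter.Tendsto (fun p : (E →L⋆[ℂ] ℂ) × E => (p.1 - q.1) p.2) (nhds q) (nhds 0) :=
    squeeze_zero_norm (fun p => (p.1 - q.1).le_opNorm p.2) h1
  have h3 := h2.add ((q.1.continuous.comp continuous_snd).tendsto q)
  simpa [ContinuousAt] using h3

lemma continuous_pairing (d m : ℕ) : Continuous fun p : Hneg1 d m × H1 d m => p.1 p.2 :=
  continuous_antilinear_apply

/-- Antilinear functionals are determined by their values on test functions. -/
lemma Hneg1_ext {d m : ℕ} {F G : Hneg1 d m}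
    (h : ∀ φ : Test d (Cm m), F (ofTest d m φ) = G (ofTest d m φ)) : F = G := by
  ext v
  exact congrFun ((denseRange_ofTest d m).equalizer F.continuous G.continuous (funext h)) v

/-! ### The graph of `L` and its core of test functions. -/

section Graph

variable {d m : ℕ} {Q : Rd d → Matrix (Fin d) (Fin d) ℝ} {V : Rd d → Matrix (Fin m) (Fin m) ℝ}
  (hQ : DiffusionHyp Q) (hV : PotentialHyp V)

lemma distA_eq (u : H1 d m) (φ : Test d (Cm m)) : distA Q V u φ
    = -(diffusion m hQ u (ofTest d m φ)) - ∫ x, inner ℂ (φ x) (matVec (V x) (fn u x)) := by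
  rw [distA, diffusion_ofTest]

/-- The operator `div (Q ∇u) - V u` with the potential cut off outside a ball. -/
def truncL {R : ℝ} (hR : 0 < R) : H1 d m →L[ℂ] Hneg1 d m :=
  -diffusion m hQ - dualMap (fnL d m) ∘L potL hV hR ∘L fnL d m

lemma truncL_apply {R : ℝ} (hR : 0 < R) (u v : H1 d m) :
    truncL hQ hV hR u v = -(diffusion m hQ u v) - inner ℂ (fn v) (potL hV hR (fn u)) := rfl

lemma truncL_ofTest {R : ℝ} (hR : 0 < R) {u : H1 d m} {φ : Test d (Cm m)}
    (h : ∀ᵐ x, R < ‖x‖ → φ x = 0 ∨ fn u x = 0) :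
    truncL hQ hV hR u (ofTest d m φ) = distA Q V u φ := by
  rw [truncL_apply, inner_potL_ofTest hV hR h, distA_eq hQ]

lemma truncL_conj {R : ℝ} (hR : 0 < R) (u v : H1 d m) :
    conj (truncL hQ hV hR u v) = truncL hQ hV.transpose hR v u := by
  rw [truncL_apply, truncL_apply, map_sub, map_neg, diffusion_conj, inner_conj_symm, inner_potL]

/-- Sobolev functions with bounded support belong to the domain. -/
lemma truncL_mem_graphL {R : ℝ} (hR : 0 < R) {u : H1 d m}
    (h : ∀ᵐ x, R < ‖x‖ → fn u x = 0) : (u, truncL hQ hV hR u) ∈ graphL hQ hV := fun _ =>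
  truncL_ofTest hQ hV hR (h.mono fun _ hx hr => Or.inr (hx hr))

/-- This is the well-definedness of `L`, a consequence of the density of test functions. -/
lemma eq_of_mem_graphL {u : H1 d m} {F G : Hneg1 d m} (hF : (u, F) ∈ graphL hQ hV)
    (hG : (u, G) ∈ graphL hQ hV) : F = G :=
  Hneg1_ext fun φ => (hF φ).trans (hG φ).symm

/-- A fixed `φ` sees `V` only on a ball, where the bounded operator `truncL` may replace `𝒜`. This
makes the graph closed. -/
lemma continuous_distA (hQ : DiffusionHyp Q) (hV : PotentialHyp V) (φ : Test d (Cm m)) :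
    Continuous fun u : H1 d m => distA Q V u φ := by
  obtain ⟨R, hR, h⟩ := exists_eq_zero_of_lt_norm φ
  have e : (fun u : H1 d m => distA Q V u φ) = fun u => truncL hQ hV hR u (ofTest d m φ) := by
    ext u
    exact (truncL_ofTest hQ hV hR (Filter.Eventually.of_forall fun x hx => Or.inl (h x hx))).symm
  rw [e]
  exact (continuous_pairing d m).comp ((truncL hQ hV hR).continuous.prodMk continuous_const)

lemma isClosed_graphL : IsClosed (graphL hQ hV : Set (H1 d m × Hneg1 d m)) := by
  have : (graphL hQ hV : Set (H1 d m × Hneg1 d m))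
      = ⋂ φ : Test d (Cm m), {p | p.2 (ofTest d m φ) = distA Q V p.1 φ} := by
    ext p
    simp only [Set.mem_iInter]
    rfl
  rw [this]
  exact isClosed_iInter fun φ => isClosed_eq
    ((continuous_pairing d m).comp (continuous_snd.prodMk continuous_const))
    ((continuous_distA hQ hV φ).comp continuous_fst)

/-- The graph of the restriction to test functions. -/
def graphTest : Submodule ℂ (H1 d m × Hneg1 d m) :=
  graphL hQ hV ⊓ (LinearMap.range (ofTest d m)).prod ⊤

lemma mem_graphTest {p : H1 d m × Hneg1 d m} :
    p ∈ graphTest hQ hV ↔ p ∈ graphL hQ hV ∧ ∃ φ, ofTest d m φ = p.1 := by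
  simp [graphTest, Submodule.mem_prod]

lemma exists_mem_graphTest (φ : Test d (Cm m)) :
    ∃ (R : ℝ) (hR : 0 < R), (ofTest d m φ, truncL hQ hV hR (ofTest d m φ)) ∈ graphTest hQ hV := by
  obtain ⟨R, hR, h⟩ := exists_eq_zero_of_lt_norm φ
  refine ⟨R, hR, (mem_graphTest hQ hV).2 ⟨truncL_mem_graphL hQ hV hR ?_, φ, rfl⟩⟩
  filter_upwards [ofTest_fn φ] with x hx hr
  rw [hx, h x hr]

/-- On functions supported in a fixed ball `L` coincides with the bounded operator `truncL`, so
convergence of the mollifications in `H1` already gives convergence in the graph. -/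
lemma mem_closure_graphTest_of_support {R : ℝ} {p : H1 d m × Hneg1 d m}
    (hp : p ∈ graphL hQ hV) (h : ∀ᵐ x, R < ‖x‖ → fn p.1 x = 0) :
    p ∈ closure (graphTest hQ hV : Set (H1 d m × Hneg1 d m)) := by
  obtain ⟨u, F⟩ := p
  -- The extra one leaves room for the larger supports of the mollifications; the maximum with zero
  -- ensures positivity.
  set r := max R 0 + 1 with hr
  have hr0 : 0 < r := by positivity
  have hRr : R + 1 ≤ r := by
    rw [hr]
    gcongr
    exact le_max_left _ _
  have hF : F = truncL hQ hV hr0 u := eq_of_mem_graphL hQ hV hp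
    (truncL_mem_graphL hQ hV hr0 (h.mono fun x hx hxr => hx (by linarith)))
  subst hF
  let A : Set (H1 d m) := {v | (v, truncL hQ hV hr0 v) ∈ graphTest hQ hV}
  have hu : u ∈ closure A := Metric.mem_closure_iff.2 fun ε hε => by
    obtain ⟨φ, h0, hφ⟩ := exists_test_norm_sub_le h (half_pos hε)
    refine ⟨ofTest d m φ, (mem_graphTest hQ hV).2 ⟨truncL_mem_graphL hQ hV hr0 ?_, φ, rfl⟩, ?_⟩
    · filter_upwards [ofTest_fn φ] with x hx hxr
      rw [hx, h0 x (by linarith)]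
    · rw [dist_comm, dist_eq_norm]
      linarith
  exact map_mem_closure (f := fun v => (v, truncL hQ hV hr0 v))
    (continuous_id.prodMk (truncL hQ hV hr0).continuous) hu fun v hv => hv

/-- `p.2 + diffusion m hQ p.1` represents `-V u`, and multiplication by `V` commutes with `χ`; the
diffusion part is simply recomputed at `χ u`. -/
lemma mulTest_mem_graphL {p : H1 d m × Hneg1 d m} (hp : p ∈ graphL hQ hV) (χ : Test d ℝ) :
    (mulTest m χ p.1, -diffusion m hQ (mulTest m χ p.1)
      + (p.2 + diffusion m hQ p.1).comp (mulTest m χ)) ∈ graphL hQ hV := by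
  intro φ
  change -(diffusion m hQ (mulTest m χ p.1) (ofTest d m φ))
    + (p.2 (mulTest m χ (ofTest d m φ)) + diffusion m hQ p.1 (mulTest m χ (ofTest d m φ))) = _
  have e : ∫ x, inner ℂ (smulTest χ φ x) (matVec (V x) (fn p.1 x))
      = ∫ x, inner ℂ (φ x) (matVec (V x) (fn (mulTest m χ p.1) x)) := by
    refine integral_congr_ae ?_
    filter_upwards [mulL_coeFn (memLp_top_test χ) (fn p.1)] with x hx
    rw [fn_mulTest, hx, ← Complex.coe_smul, matVec_smul, Complex.coe_smul,
      inner_smul_right_eq_smul, ← inner_smul_left_eq_smul]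
    rfl
  rw [mulTest_ofTest, hp, distA_eq hQ, distA_eq hQ, e]
  ring

open Filter Topology in
/-- The test functions are a core: the closure of the restriction contains the whole graph. -/
lemma graphL_subset_closure : (graphL hQ hV : Set (H1 d m × Hneg1 d m))
    ⊆ closure (graphTest hQ hV : Set (H1 d m × Hneg1 d m)) := by
  intro p hp
  obtain ⟨χ, hχ⟩ := exists_isCutoff d
  have h1 := hχ.tendsto_mulTest p.1
  -- With `D` the diffusion operator, the limit is `-D u + (F + D u) = F`.
  have h2 := (((diffusion m hQ).continuous.tendsto p.1).comp h1).neg.add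
    (hχ.tendsto_comp_mulTest (p.2 + diffusion m hQ p.1))
  rw [neg_add_eq_sub, add_sub_cancel_right] at h2
  refine isClosed_closure.mem_of_tendsto (h1.prodMk_nhds h2) (Eventually.of_forall fun n => ?_)
  obtain ⟨R, -, hR⟩ := exists_eq_zero_of_lt_norm (χ n)
  exact mem_closure_graphTest_of_support hQ hV (mulTest_mem_graphL hQ hV hp (χ n))
    (fn_mulTest_ae_eq_zero hR p.1)

lemma closure_graphTest :
    closure (graphTest hQ hV : Set (H1 d m × Hneg1 d m)) = graphL hQ hV :=
  Set.Subset.antisymm (closure_minimal (fun _ hp => hp.1) (isClosed_graphL hQ hV))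
    (graphL_subset_closure hQ hV)

/-- Accretivity of the potential extends from test functions to the whole domain. -/
lemma re_le_of_mem_graphL {p : H1 d m × Hneg1 d m} (hp : p ∈ graphL hQ hV) :
    (diffusion m hQ p.1 p.1).re ≤ -(p.2 p.1).re := by
  have hc : IsClosed {p : H1 d m × Hneg1 d m | (diffusion m hQ p.1 p.1).re ≤ -(p.2 p.1).re} :=
    isClosed_le (Complex.continuous_re.comp ((continuous_pairing d m).comp
        (((diffusion m hQ).continuous.comp continuous_fst).prodMk continuous_fst)))
      (continuous_neg.comp (Complex.continuous_re.comp ((continuous_pairing d m).comp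
        (continuous_snd.prodMk continuous_fst))))
  -- The potential does not appear in the inequality, whose two sides are continuous on the graph;
  -- it is therefore enough to treat test functions, for which `∫ ⟨V φ, φ⟩` converges.
  refine closure_minimal ?_ hc (graphL_subset_closure hQ hV hp)
  rintro ⟨u, F⟩ hq
  obtain ⟨hF, φ, rfl⟩ := (mem_graphTest hQ hV).1 hq
  have e : ∫ x, inner ℂ (φ x) (matVec (V x) (fn (ofTest d m φ) x))
      = ∫ x, inner ℂ (φ x) (matVec (V x) (φ x)) := by
    refine integral_congr_ae ?_
    filter_upwards [ofTest_fn φ] with x hx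
    rw [hx]
  have hi : Integrable fun x => inner ℂ (φ x) (matVec (V x) (φ x)) := by
    refine (integrable_potential hV (fn (ofTest d m φ)) φ).congr ?_
    filter_upwards [ofTest_fn φ] with x hx
    rw [hx]
  have h0 : 0 ≤ (∫ x, inner ℂ (φ x) (matVec (V x) (φ x))).re := by
    rw [show (∫ x, inner ℂ (φ x) (matVec (V x) (φ x))).re
      = ∫ x, (inner ℂ (φ x) (matVec (V x) (φ x))).re from (integral_re hi).symm]
    exact integral_nonneg fun x => hV.accretive x (φ x)
  have h1 := hF φ
  change F (ofTest d m φ) = distA Q V (ofTest d m φ) φ at h1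
  rw [distA_eq hQ, e] at h1
  change _ ≤ -(F (ofTest d m φ)).re
  rw [h1, Complex.sub_re, Complex.neg_re]
  change (diffusion m hQ (ofTest d m φ) (ofTest d m φ)).re ≤ _
  linarith

end Graph

/-! ### Surjectivity of closed coercive relations. -/

/-- A closed relation from a Hilbert space to a Banach space that the Hilbert space maps onto is
surjective if it is bounded below and its range has a trivial orthogonal complement. -/
lemma exists_mem_of_isClosed {H Y : Type*} [NormedAddCommGroup H] [InnerProductSpace ℂ H]
    [CompleteSpace H] [NormedAddCommGroup Y] [NormedSpace ℂ Y] [CompleteSpace Y]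
    {Γ : Submodule ℂ (H × Y)} (hΓ : IsClosed (Γ : Set (H × Y))) (J : H →L[ℂ] Y)
    (hJ : Function.Surjective J) {c : ℝ} (h : ∀ p ∈ Γ, ‖p.1‖ ≤ c * ‖p.2‖)
    (hd : ∀ w : H, (∀ p ∈ Γ, ∀ z, J z = p.2 → inner ℂ z w = 0) → w = 0) (f : Y) :
    ∃ u, (u, f) ∈ Γ := by
  have : CompleteSpace Γ := hΓ.completeSpace_coe
  let S : Γ →L[ℂ] Y := ContinuousLinearMap.snd ℂ H Y ∘L Γ.subtypeL
  obtain ⟨k, hk⟩ : ∃ k : NNReal, ∀ p : Γ, ‖p‖ ≤ k * ‖S p‖ := by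
    -- The product carries the maximum norm: `c` handles the first component and one the second.
    refine ⟨⟨max c 1, by positivity⟩, fun p => max_le ((h p.1 p.2).trans ?_) ?_⟩
    · exact mul_le_mul_of_nonneg_right (le_max_left c 1) (norm_nonneg _)
    · exact le_mul_of_one_le_left (norm_nonneg _) (le_max_right c 1)
  have hr : IsClosed (Set.range S) :=
    (AddMonoidHomClass.antilipschitz_of_bound S hk).isClosed_range S.uniformContinuous
  -- The closed range is pulled back to the Hilbert space, where a closed subspace with trivial
  -- orthogonal complement is everything.
  let K : Submodule ℂ H := (LinearMap.range S.toLinearMap).comap J.toLinearMap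
  have hKc : IsClosed (K : Set H) := hr.preimage J.continuous
  have : CompleteSpace K := hKc.completeSpace_coe
  have hK : Kᗮ = ⊥ := (Submodule.eq_bot_iff _).2 fun w hw => hd w fun p hp z hz =>
    (Submodule.mem_orthogonal K w).1 hw z ⟨⟨p, hp⟩, hz.symm⟩
  rw [Submodule.orthogonal_eq_bot_iff] at hK
  obtain ⟨w, rfl⟩ := hJ f
  obtain ⟨p, hp⟩ : w ∈ K := by
    rw [hK]
    trivial
  have hp' : p.1.2 = J w := hp
  exact ⟨p.1.1, hp' ▸ p.2⟩

/-- A closed coercive relation from a Hilbert space to its antidual is surjective if its range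
annihilates only zero. -/
lemma exists_mem_of_isClosed_of_coercive {H : Type*} [NormedAddCommGroup H]
    [InnerProductSpace ℂ H] [CompleteSpace H] {Γ : Submodule ℂ (H × (H →L⋆[ℂ] ℂ))}
    (hΓ : IsClosed (Γ : Set (H × (H →L⋆[ℂ] ℂ)))) {c : ℝ} (hc : 0 < c)
    (h : ∀ p ∈ Γ, c * ‖p.1‖ ^ 2 ≤ (p.2 p.1).re)
    (hd : ∀ w : H, (∀ p ∈ Γ, p.2 w = 0) → w = 0) (f : H →L⋆[ℂ] ℂ) :
    ∃ u, (u, f) ∈ Γ := by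
  let J : H →L[ℂ] H →L⋆[ℂ] ℂ := innerSLFlip ℂ
  have hJ : ∀ w v, J w v = inner ℂ v w := fun w v => rfl
  have hJs : Function.Surjective J := fun G => by
    obtain ⟨w, hw⟩ := exists_eq_inner G
    refine ⟨w, ?_⟩
    ext v
    exact (hw v).symm
  have hb : ∀ p ∈ Γ, ‖p.1‖ ≤ c⁻¹ * ‖p.2‖ := fun p hp => by
    rw [inv_mul_eq_div, le_div_iff₀ hc]
    rcases (norm_nonneg p.1).eq_or_lt with h0 | h0
    · rw [← h0, zero_mul]
      exact norm_nonneg _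
    · refine le_of_mul_le_mul_right ?_ h0
      have := (h p hp).trans ((Complex.re_le_norm _).trans (p.2.le_opNorm p.1))
      linarith
  refine exists_mem_of_isClosed hΓ J hJs hb (fun w hw => hd w fun p hp => ?_) f
  obtain ⟨z, hz⟩ := hJs p.2
  rw [← hz, hJ, ← inner_conj_symm, hw p hp z hz, map_zero]

/-! ### Adjoints, the resolvent equation and maximal monotonicity. -/

section Operator

variable {d m : ℕ} {Q : Rd d → Matrix (Fin d) (Fin d) ℝ} {V : Rd d → Matrix (Fin m) (Fin m) ℝ}
  (hQ : DiffusionHyp Q) (hV : PotentialHyp V)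

/-- `Submodule.toLinearPMap` has the prescribed graph only if that graph is single-valued, so this
is where uniqueness of `F` enters. -/
lemma graph_opL : (opL hQ hV).graph = graphL hQ hV := by
  refine Submodule.toLinearPMap_graph_eq _ fun p hp h0 => ?_
  refine eq_of_mem_graphL hQ hV (u := p.1) hp ?_
  rw [h0]
  exact (graphL hQ hV).zero_mem

/-- `domRestrict` intersects the two domains; the content is that no test function is lost, because
`V φ` is bounded with bounded support. -/
lemma domain_opL₀ : (opL₀ hQ hV).domain = LinearMap.range (ofTest d m) := by
  rw [opL₀, LinearPMap.domRestrict_domain, inf_eq_left]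
  rintro _ ⟨φ, rfl⟩
  obtain ⟨R, hR, h⟩ := exists_mem_graphTest hQ hV φ
  refine LinearPMap.mem_domain_of_mem_graph (y := truncL hQ hV hR (ofTest d m φ)) ?_
  rw [graph_opL]
  exact h.1

lemma graph_opL₀ : (opL₀ hQ hV).graph = graphTest hQ hV := by
  ext ⟨u, F⟩
  rw [mem_graphTest, ← graph_opL, LinearPMap.mem_graph_iff, LinearPMap.mem_graph_iff]
  constructor
  · rintro ⟨y, rfl, rfl⟩
    have hy : (y : H1 d m) ∈ LinearMap.range (ofTest d m) ⊓ (opL hQ hV).domain := y.2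
    exact ⟨⟨⟨y, hy.2⟩, rfl, (LinearPMap.domRestrict_apply rfl).symm⟩, hy.1⟩
  · rintro ⟨⟨y, rfl, rfl⟩, hφ⟩
    exact ⟨⟨y, ⟨hφ, y.2⟩⟩, rfl, LinearPMap.domRestrict_apply rfl⟩

lemma topologicalClosure_graph_opL₀ :
    (opL₀ hQ hV).graph.topologicalClosure = (opL hQ hV).graph := by
  rw [graph_opL₀, graph_opL]
  exact SetLike.coe_injective (closure_graphTest hQ hV)

lemma mem_graph_neg_opL {p : H1 d m × Hneg1 d m} :
    p ∈ (-opL hQ hV).graph ↔ (p.1, -p.2) ∈ graphL hQ hV := by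
  rw [← graph_opL, LinearPMap.mem_graph_iff, LinearPMap.mem_graph_iff]
  refine exists_congr fun y => and_congr_right fun _ => ?_
  change -(opL hQ hV y) = p.2 ↔ opL hQ hV y = -p.2
  rw [neg_eq_iff_eq_neg]

/-- On a test function `L` is `truncL` for a large ball, and conjugating the form of `truncL`
transposes the potential. The adjoint condition on `(v, G)` thus becomes the equation defining the
graph for `Vᵀ`, with no regularity to prove. -/
lemma adjointGraph_graphTest :
    adjointGraph (graphTest hQ hV : Set (H1 d m × Hneg1 d m)) = graphL hQ hV.transpose := by
  ext ⟨v, G⟩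
  have key : ∀ (φ : Test d (Cm m)) (F : Hneg1 d m), (ofTest d m φ, F) ∈ graphL hQ hV →
      conj (F v) = distA Q (fun x => (V x).transpose) v φ := fun φ F hF => by
    obtain ⟨R, hR, h⟩ := exists_eq_zero_of_lt_norm φ
    have h1 : F = truncL hQ hV hR (ofTest d m φ) :=
      eq_of_mem_graphL hQ hV hF (truncL_mem_graphL hQ hV hR (by
        filter_upwards [ofTest_fn φ] with x hx hr
        rw [hx, h x hr]))
    rw [h1, truncL_conj,
      truncL_ofTest hQ hV.transpose hR (Filter.Eventually.of_forall fun x hx => Or.inl (h x hx))]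
  constructor
  · intro hv φ
    obtain ⟨R, hR, h⟩ := exists_mem_graphTest hQ hV φ
    exact (hv _ h).trans (key φ _ h.1)
  · rintro hv ⟨u, F⟩ hq
    obtain ⟨hF, φ, rfl⟩ := (mem_graphTest hQ hV).1 hq
    exact (hv φ).trans (key φ F hF).symm

/-- For fixed `p`, the adjoint condition is closed in `q`. -/
lemma adjointGraph_closure (S : Set (H1 d m × Hneg1 d m)) :
    adjointGraph (closure S) = adjointGraph S := by
  refine Set.Subset.antisymm (fun p hp q hq => hp q (subset_closure hq)) fun p hp => ?_
  refine closure_minimal (s := S) (t := {q | p.2 q.1 = conj (q.2 p.1)}) hp (isClosed_eq ?_ ?_)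
  · exact p.2.continuous.comp continuous_fst
  · exact Complex.continuous_conj.comp
      ((continuous_pairing d m).comp (continuous_snd.prodMk continuous_const))

lemma adjointGraph_graphL : adjointGraph (graphL hQ hV : Set (H1 d m × Hneg1 d m))
    = graphL hQ hV.transpose := by
  rw [← closure_graphTest, adjointGraph_closure, adjointGraph_graphTest]

lemma emb_self_re (u : H1 d m) : (emb d m u u).re = ‖fn u‖ ^ 2 :=
  inner_self_eq_norm_sq (𝕜 := ℂ) (fn u)

lemma diffusion_re_nonneg (u : H1 d m) : 0 ≤ (diffusion m hQ u u).re := by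
  obtain ⟨η, _, hη, _, h⟩ := hQ.elliptic
  exact le_trans (by positivity) (diffusion_re_ge hQ (fun x ξ => (h x ξ).1) u)

/-- The operator `1 - L` is coercive. -/
lemma exists_coercive : ∃ c > 0, ∀ p ∈ graphL hQ hV,
    c * ‖p.1‖ ^ 2 ≤ ((emb d m p.1 - p.2) p.1).re := by
  obtain ⟨η, _, hη, _, h⟩ := hQ.elliptic
  -- One comes from the `L²` term of `emb`, `η` from ellipticity on the gradient.
  refine ⟨min 1 η, lt_min one_pos hη, fun p hp => ?_⟩
  have h2 := diffusion_re_ge hQ (fun x ξ => (h x ξ).1) p.1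
  have h3 := re_le_of_mem_graphL hQ hV hp
  have h4 : min 1 η * ‖fn p.1‖ ^ 2 ≤ 1 * ‖fn p.1‖ ^ 2 := by
    gcongr
    exact min_le_left _ _
  have h5 : min 1 η * ∑ i, ‖grad p.1 i‖ ^ 2 ≤ η * ∑ i, ‖grad p.1 i‖ ^ 2 := by
    gcongr
    exact min_le_right _ _
  rw [sub_apply, Complex.sub_re, emb_self_re, norm_sq_H1, mul_add]
  linarith

lemma eq_zero_of_emb_sub_eq_zero {p : H1 d m × Hneg1 d m} (hp : p ∈ graphL hQ hV)
    (h : emb d m p.1 - p.2 = 0) : p.1 = 0 := by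
  obtain ⟨c, hc, hcp⟩ := exists_coercive hQ hV
  have h1 := hcp p hp
  rw [h, zero_apply, Complex.zero_re] at h1
  have h2 : ‖p.1‖ ^ 2 ≤ 0 := le_of_mul_le_mul_left (by rwa [mul_zero]) hc
  exact norm_eq_zero.1 (sq_eq_zero_iff.1 (le_antisymm h2 (sq_nonneg _)))

/-- The map `(u, F) ↦ (u, u - F)`. -/
def resolventShift (d m : ℕ) : (H1 d m × Hneg1 d m) →ₗ[ℂ] H1 d m × Hneg1 d m :=
  (LinearMap.fst ℂ (H1 d m) (Hneg1 d m)).prod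
    (emb d m ∘ₗ LinearMap.fst ℂ (H1 d m) (Hneg1 d m) - LinearMap.snd ℂ (H1 d m) (Hneg1 d m))

lemma continuous_resolventShift (d m : ℕ) : Continuous (resolventShift d m) :=
  continuous_fst.prodMk
    (((dualMap (fnL d m) ∘L fnL d m).continuous.comp continuous_fst).sub continuous_snd)

/-- The resolvent equation is solvable for every right-hand side. -/
lemma exists_mem_graphL_emb_sub (f : Hneg1 d m) : ∃ u, (u, emb d m u - f) ∈ graphL hQ hV := by
  obtain ⟨c, hc, h⟩ := exists_coercive hQ hV
  -- The shift `(u, F) ↦ (u, u - F)` is an involution, so the preimage of the graph of `L` is the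
  -- graph of `1 - L`.
  have hcl : IsClosed ((graphL hQ hV).comap (resolventShift d m) : Set (H1 d m × Hneg1 d m)) :=
    (isClosed_graphL hQ hV).preimage (continuous_resolventShift d m)
  have hco : ∀ p ∈ (graphL hQ hV).comap (resolventShift d m), c * ‖p.1‖ ^ 2 ≤ (p.2 p.1).re := by
    intro p hp
    have h1 := h _ hp
    change c * ‖p.1‖ ^ 2 ≤ ((emb d m p.1 - (emb d m p.1 - p.2)) p.1).re at h1
    rwa [sub_sub_cancel] at h1
  refine exists_mem_of_isClosed_of_coercive (H := H1 d m) hcl hc hco (fun w hw => ?_) f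
  -- If `w` annihilates the range of `1 - L`, then `[Lφ, w] = [φ, w]`, whose conjugate is `[w, φ]`;
  -- so `w` solves the homogeneous equation for the adjoint, that is, for `Vᵀ`.
  have hw' : (w, emb d m w) ∈ adjointGraph (graphTest hQ hV : Set (H1 d m × Hneg1 d m)) := by
    intro q hq
    have hm : (q.1, emb d m q.1 - q.2) ∈ (graphL hQ hV).comap (resolventShift d m) := by
      change (q.1, emb d m q.1 - (emb d m q.1 - q.2)) ∈ graphL hQ hV
      rw [sub_sub_cancel]
      exact hq.1
    have h1 : emb d m q.1 w = q.2 w := sub_eq_zero.1 (hw _ hm)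
    rw [← h1]
    exact (inner_conj_symm (𝕜 := ℂ) (fn q.1) (fn w)).symm
  rw [adjointGraph_graphTest] at hw'
  exact eq_zero_of_emb_sub_eq_zero hQ hV.transpose hw' (sub_self (emb d m w))

lemma exists_emb_sub_eq (f : Hneg1 d m) : ∃ p ∈ graphL hQ hV, emb d m p.1 - p.2 = f := by
  obtain ⟨u, hu⟩ := exists_mem_graphL_emb_sub hQ hV f
  exact ⟨_, hu, sub_sub_cancel _ _⟩

lemma eq_of_emb_sub_eq {p q : H1 d m × Hneg1 d m} (hp : p ∈ graphL hQ hV) (hq : q ∈ graphL hQ hV)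
    (h : emb d m p.1 - p.2 = emb d m q.1 - q.2) : p.1 = q.1 := by
  refine sub_eq_zero.1 (eq_zero_of_emb_sub_eq_zero hQ hV ((graphL hQ hV).sub_mem hp hq) ?_)
  rw [Prod.fst_sub, Prod.snd_sub, map_sub, sub_sub_sub_comm, h, sub_self]

lemma isMonotone_neg_opL : IsMonotone ((-opL hQ hV).graph : Set (H1 d m × Hneg1 d m)) := by
  intro p hp q hq
  have h := (mem_graph_neg_opL hQ hV).1 ((-opL hQ hV).graph.sub_mem hp hq)
  have h1 := re_le_of_mem_graphL hQ hV h
  have h2 := diffusion_re_nonneg hQ (p - q).1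
  change 0 ≤ ((p - q).2 (p - q).1).re
  refine (h2.trans h1).trans (le_of_eq ?_)
  rw [neg_apply, Complex.neg_re, neg_neg]

/-- Minty's argument: if `(v, G)` belongs to a monotone extension, solve `u - L u = v + G`. Then `G
+ L u = u - v`, so monotonicity forces `-‖u - v‖² ≥ 0` in the `L²` norm. This suffices, although
weaker than the `H1` norm, since the underlying function determines the element. -/
lemma isMaximalMonotone_neg_opL :
    IsMaximalMonotone ((-opL hQ hV).graph : Set (H1 d m × Hneg1 d m)) := by
  refine ⟨isMonotone_neg_opL hQ hV, fun T hT hs => Set.Subset.antisymm ?_ hs⟩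
  rintro ⟨v, G⟩ hv
  obtain ⟨⟨u, F⟩, hu, hf⟩ := exists_emb_sub_eq hQ hV (emb d m v + G)
  have hu' : (u, -F) ∈ (-opL hQ hV).graph :=
    (mem_graph_neg_opL hQ hV).2 (by rwa [neg_neg])
  have h1 := hT _ hv _ (hs hu')
  have e : G - -F = emb d m (u - v) := by
    rw [map_sub, sub_neg_eq_add]
    have : emb d m u - F = emb d m v + G := hf
    rw [sub_eq_iff_eq_add.1 this]
    abel
  change 0 ≤ ((G - -F) (v - u)).re at h1
  rw [e, ← neg_sub u v, map_neg, Complex.neg_re, emb_self_re] at h1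
  have h2 : fn (u - v) = 0 := by
    rw [← norm_eq_zero, ← sq_eq_zero_iff]
    exact le_antisymm (by linarith) (sq_nonneg _)
  have h3 : u = v := sub_eq_zero.1 (fn_eq_zero h2)
  subst h3
  rw [sub_self, map_zero, sub_neg_eq_add, add_eq_zero_iff_eq_neg] at e
  rw [e]
  exact hu'

lemma existsUnique_emb_sub_opL (f : Hneg1 d m) :
    ∃! u : (opL hQ hV).domain, emb d m u - opL hQ hV u = f := by
  obtain ⟨p, hp, hf⟩ := exists_emb_sub_eq hQ hV f
  have hm : ∀ u : (opL hQ hV).domain, ((u : H1 d m), opL hQ hV u) ∈ graphL hQ hV := fun u => by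
    rw [← graph_opL]
    exact (opL hQ hV).mem_graph u
  obtain ⟨u, hu, hF⟩ := (opL hQ hV).mem_graph_iff.1 ((graph_opL hQ hV).symm ▸ hp)
  refine ⟨u, by rw [← hf, ← hu, ← hF], fun v hv => Subtype.ext ?_⟩
  refine (eq_of_emb_sub_eq hQ hV (hm v) hp (hv.trans hf.symm)).trans hu.symm

end Operator

end VecSchrodinger

end

theorem theorem3p2 (d m : ℕ) (hd : 1 ≤ d) (hm : 1 ≤ m)
    (Q : VecSchrodinger.Rd d → Matrix (Fin d) (Fin d) ℝ)
    (V : VecSchrodinger.Rd d → Matrix (Fin m) (Fin m) ℝ)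
    (hQ : VecSchrodinger.DiffusionHyp Q) (hV : VecSchrodinger.PotentialHyp V) :
    -- `L` is a well-defined operator: `𝒜 u` determines at most one element of the antidual
    (VecSchrodinger.opL hQ hV).graph = VecSchrodinger.graphL hQ hV ∧
    -- all test functions belong to the domain of `L₀`
    (VecSchrodinger.opL₀ hQ hV).domain = LinearMap.range (VecSchrodinger.ofTest d m) ∧
    -- `-L` is maximal monotone, and `u - L u = f` is uniquely solvable for every `f`
    VecSchrodinger.IsMaximalMonotone
      (((-VecSchrodinger.opL hQ hV).graph : Submodule ℂ _) :
        Set (VecSchrodinger.H1 d m × VecSchrodinger.Hneg1 d m)) ∧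
    (∀ f : VecSchrodinger.Hneg1 d m, ∃! u : (VecSchrodinger.opL hQ hV).domain,
      VecSchrodinger.emb d m u - VecSchrodinger.opL hQ hV u = f) ∧
    -- `L` is the closure of `L₀` and equals the second adjoint of `L₀`
    (VecSchrodinger.opL₀ hQ hV).IsClosable ∧
    (VecSchrodinger.opL₀ hQ hV).closure = VecSchrodinger.opL hQ hV ∧
    VecSchrodinger.adjointGraph (VecSchrodinger.adjointGraph
      (((VecSchrodinger.opL₀ hQ hV).graph : Submodule ℂ _) :
        Set (VecSchrodinger.H1 d m × VecSchrodinger.Hneg1 d m))) =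
      (((VecSchrodinger.opL hQ hV).graph : Submodule ℂ _) :
        Set (VecSchrodinger.H1 d m × VecSchrodinger.Hneg1 d m)) := by
  open VecSchrodinger in
  have hcl : (opL₀ hQ hV).IsClosable := ⟨opL hQ hV, topologicalClosure_graph_opL₀ hQ hV⟩
  refine ⟨graph_opL hQ hV, domain_opL₀ hQ hV, isMaximalMonotone_neg_opL hQ hV,
    existsUnique_emb_sub_opL hQ hV, hcl, LinearPMap.eq_of_eq_graph ?_, ?_⟩
  · rw [← hcl.graph_closure_eq_closure_graph, topologicalClosure_graph_opL₀]
  -- The second adjoint is computed for the transposed potential, and transposing twice gives `V`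
  -- back definitionally.
  · rw [graph_opL₀, graph_opL, adjointGraph_graphTest, adjointGraph_graphL]
    rfl
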